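/- Theorem (pointwise bound on the scattering amplitude). Let $M>0$ and let $\hat H=-\frac{1}{2M}\nabla^2+V$ on $\mathbb R^3$, where $V:\mathbb R^3\to\mathbb R$ is a short-range potential: locally square-integrable (for example bounded) with $V(x)=O(e^{-|x|/a})$ as $|x|\to\infty$ for some $a>0$. Let $k\in\mathbb R^3\setminus\{0\}$ and $E=\frac{|k|^2}{2M}$. A continuous function $\psi:\mathbb R^3\to\mathbb C$ is said to have ingoing wave $e^{ik\cdot x}$ and outgoing amplitude $f:S^2\to\mathbb C$ if, with $r=|x|$, $$\psi(x)=e^{ik\cdot x}+\frac{e^{i|k|r}}{r}\,f\!\left(\frac{x}{r}\right)+O(r^{-2})\qquad (r\to\infty),$$ uniformly in the direction $x/r$. Such a $\psi$ is called an approximate scattering state; it is an exact scattering state if in addition $(E-\hat H)\psi=0$. Here and below, $(E-\hat H)\psi$ is taken in the sense of distributions. Let $\psi$ be an exact scattering state with ingoing wave $e^{ik\cdot x}$ and outgoing amplitude $f$, and let $\tilde\psi$ be an approximate scattering state with the same ingoing wave $e^{ik\cdot x}$ and outgoing amplitude $\tilde f$, such that $(E-\hat H)\tilde\psi$ is a locally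 integrable function. Let $p\in\mathbb R^3$ with $|p|=|k|$, and write $\hat p=p/|p|$. Then: 1. If $\xi$ is an exact scattering state with ingoing wave $e^{-ip\cdot x}$ (with any outgoing amplitude), then $$|\tilde f(\hat p)-f(\hat p)|\le\frac{M\,\|\xi\|_\infty}{\pi}\int_{\mathbb R^3}|(E-\hat H)\tilde\psi|\,dx .$$ 2. If $V$ is spherically symmetric, then also $$|\tilde f(\hat p)-f(\hat p)|\le\frac{M\,\|\psi\|_\infty}{\pi}\int_{\mathbb R^3}|(E-\hat H)\tilde\psi|\,dx .$$ Here $\|\xi\|_\infty=\sup_x|\xi(x)|$, and the integrals may be $+\infty$. -/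

import Mathlib

open MeasureTheory
open scoped ContDiff ENNReal Laplacian

/-- Physical space `ℝ³` with its Euclidean norm. -/
abbrev Space3 : Type := EuclideanSpace ℝ (Fin 3)

/-- The celestial sphere: the unit sphere of `ℝ³`. -/
abbrev CelestialSphere : Type := Metric.sphere (0 : Space3) 1

/-- A real short-range potential: locally square-integrable (for instance bounded), and
`V(x) = O(e^{-|x|/a})` at infinity for some length `a > 0`. -/
structure IsShortRange (V : Space3 → ℝ) : Prop where
  locally_sq_integrable : ∀ K : Set Space3, IsCompact K → MemLp V 2 (volume.restrict K)
  exp_decay : ∃ a : ℝ, 0 < a ∧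
    V =O[Bornology.cobounded Space3] fun x => Real.exp (-‖x‖ / a)

/-- The kinetic energy `E = |k|² / (2M)` of a particle of mass `M` and momentum `k`. -/
noncomputable def kineticEnergy (M : ℝ) (k : Space3) : ℝ := ‖k‖ ^ 2 / (2 * M)

/-- The plane wave `e^{ik·x}`. -/
noncomputable def planeWave (k x : Space3) : ℂ :=
  Complex.exp (Complex.I * ((inner ℝ k x : ℝ) : ℂ))

/-- `IsSchrodingerViolation M V E ψ g` says that `(E - H)ψ = g` in the sense of distributions on
`ℝ³`, where `H = -∇²/(2M) + V` and `g` is a locally integrable function: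
`∫ g η = ∫ ψ (E η + ∇²η/(2M) - V η)` for every smooth compactly supported `η`. -/
def IsSchrodingerViolation (M : ℝ) (V : Space3 → ℝ) (E : ℝ) (ψ g : Space3 → ℂ) : Prop :=
  LocallyIntegrable g volume ∧
    ∀ η : Space3 → ℂ, ContDiff ℝ ∞ η → HasCompactSupport η →
      ∫ x, g x * η x =
        ∫ x, ψ x * ((E : ℂ) * η x + (Δ η) x / (2 * (M : ℂ)) - (V x : ℂ) * η x)

/-- `ψ` is a (continuous) wavefunction with ingoing plane wave `e^{ik·x}` and outgoing amplitude
`f`: uniformly in the direction `n = x/r`, as `r = |x| → ∞`,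
`ψ(x) = e^{ik·x} + (e^{i|k|r} / r) f(n) + O(r⁻²)`.
This is an approximate scattering state; `ψ` need not be an eigenstate. -/
structure HasScatteringForm (k : Space3) (ψ : Space3 → ℂ) (f : CelestialSphere → ℂ) : Prop where
  continuous : Continuous ψ
  asymptotics : ∃ C r₀ : ℝ, 0 < r₀ ∧ ∀ r : ℝ, r₀ ≤ r → ∀ n : CelestialSphere,
    ‖ψ (r • (n : Space3)) - planeWave k (r • (n : Space3))
      - Complex.exp (Complex.I * ((‖k‖ * r : ℝ) : ℂ)) / (r : ℂ) * f n‖ ≤ C / r ^ 2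

/-- An exact scattering state of `H = -∇²/(2M) + V` with ingoing plane wave `e^{ik·x}` and outgoing
amplitude `f`: it has the scattering form and satisfies `(E - H)ψ = 0` with `E = |k|²/(2M)`. -/
structure IsExactScatteringState (M : ℝ) (V : Space3 → ℝ) (k : Space3)
    (ψ : Space3 → ℂ) (f : CelestialSphere → ℂ) : Prop where
  form : HasScatteringForm k ψ f
  eigenstate : IsSchrodingerViolation M V (kineticEnergy M k) ψ 0

/-- The supremum norm `‖ψ‖_∞ = sup_x |ψ(x)|`, as an extended nonnegative real. -/
noncomputable def supNorm (ψ : Space3 → ℂ) : ℝ≥0∞ := ⨆ x, ‖ψ x‖ₑ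

/-- The `L¹` norm `∫ |g|`, as an extended nonnegative real. -/
noncomputable def lOneNorm (g : Space3 → ℂ) : ℝ≥0∞ := ∫⁻ x, ‖g x‖ₑ

/-!
Put `κ = ‖k‖`. The difference `χ = ψt - ψ` is an outgoing solution of `(Δ + κ²) χ = s` with
source `s = 2M (g + V χ)`, and for an exact state `ξ` with ingoing momentum `-p` the scattered part
`ξ - e^{-ip·x}` is an outgoing solution with source `t = 2M V ξ`. Green's second identity on large
balls has no boundary term for two outgoing waves, so `∫ s (ξ - e^{-ip·x}) = ∫ χ t`. On the other
hand the amplitude of `χ` in the direction `p` is `-(1/4π) ∫ s e^{-ip·x}`. Together they give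
`-4π (ft - f)(p/‖p‖) = ∫ (s ξ - χ t) = 2M ∫ g ξ`, in which the potential has cancelled. If `V` is
spherically symmetric, `ξ` may be taken to be `ψ` composed with the reflection exchanging `k` and
`-p`, and the supremum of `|ψ|` is unchanged.

The amplitude formula is itself an instance of reciprocity, against spherical waves smoothed at a
scale `δ` and centred at a far point `R y`. As `s` is merely integrable it may be large near that
point, so the estimates are averaged over `y` in a shell before `R → ∞`; then `δ → 0`.
-/

namespace Scattering

open Bornology Filter NormedSpace Topology

/-! ### Green's identities -/

section VectorCalculus

variable {E : Type*} [NormedAddCommGroup E] [InnerProductSpace ℝ E]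

section Green

/-- The field `v ∇u - u ∇v` whose divergence is `v Δu - u Δv`. -/
noncomputable def greenCurrent (u v : E → ℂ) (x : E) : E →L[ℝ] ℂ :=
  v x • fderiv ℝ u x - u x • fderiv ℝ v x

lemma contDiff_greenCurrent {u v : E → ℂ} (hu : ContDiff ℝ 2 u) (hv : ContDiff ℝ 2 v) :
    ContDiff ℝ 1 (greenCurrent u v) := by
  have hu' : ContDiff ℝ 1 (fderiv ℝ u) := hu.fderiv_right (by norm_num)
  have hv' : ContDiff ℝ 1 (fderiv ℝ v) := hv.fderiv_right (by norm_num)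
  exact ((hv.of_le one_le_two).smul hu').sub ((hu.of_le one_le_two).smul hv')

variable [FiniteDimensional ℝ E]

/-- The complex bilinear extension of the inner product of gradients: `dot (du) (dv) = ∇u · ∇v`. -/
noncomputable def dot (α β : E →L[ℝ] ℂ) : ℂ :=
  ∑ i, α (stdOrthonormalBasis ℝ E i) * β (stdOrthonormalBasis ℝ E i)

/-- The divergence of a complex vector field, encoded as a field of covectors so that the
Laplacian is the divergence of the derivative. -/
noncomputable def divergence (W : E → E →L[ℝ] ℂ) (x : E) : ℂ :=
  ∑ i, fderiv ℝ W x (stdOrthonormalBasis ℝ E i) (stdOrthonormalBasis ℝ E i)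

lemma dot_comm (α β : E →L[ℝ] ℂ) : dot α β = dot β α := by
  simp only [dot, mul_comm]

lemma continuous_dot {α β : E → E →L[ℝ] ℂ} (hα : Continuous α) (hβ : Continuous β) :
    Continuous fun x => dot (α x) (β x) := by
  unfold dot
  fun_prop

lemma laplacian_eq_divergence_fderiv (u : E → ℂ) : Δ u = divergence (fderiv ℝ u) := by
  ext x
  simp [InnerProductSpace.laplacian_eq_iteratedFDeriv_stdOrthonormalBasis, divergence,
    iteratedFDeriv_two_apply]

lemma laplacian_eq_sum_fderiv {u : E → ℂ} (hu : ContDiff ℝ 2 u) (x : E) :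
    (Δ u) x = ∑ i, fderiv ℝ (fun y => fderiv ℝ u y (stdOrthonormalBasis ℝ E i)) x
      (stdOrthonormalBasis ℝ E i) := by
  have hdiff : DifferentiableAt ℝ (fderiv ℝ u) x :=
    (hu.fderiv_right (m := 1) (by norm_num)).differentiable one_ne_zero x
  simp [laplacian_eq_divergence_fderiv, divergence,
    fderiv_clm_apply hdiff (differentiableAt_const _)]

lemma laplacian_comp_isometry_add (u : E → ℂ) (A : E ≃ₗᵢ[ℝ] E) (b x : E) :
    (Δ fun y => u (A y + b)) x = (Δ u) (A x + b) := by
  let e := stdOrthonormalBasis ℝ E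
  have hcomp : (fun y => u (A y + b)) = (fun z => u (z + b)) ∘ A.toContinuousLinearEquiv := rfl
  rw [InnerProductSpace.laplacian_eq_iteratedFDeriv_orthonormalBasis _ e,
    InnerProductSpace.laplacian_eq_iteratedFDeriv_orthonormalBasis u (e.map A)]
  refine Finset.sum_congr rfl fun i _ => ?_
  rw [hcomp, ← iteratedFDerivWithin_univ, ← Set.preimage_univ (f := A.toContinuousLinearEquiv),
    ContinuousLinearEquiv.iteratedFDerivWithin_comp_right _ _ uniqueDiffOn_univ (Set.mem_univ _),
    iteratedFDerivWithin_univ, iteratedFDeriv_comp_add_right]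
  simp only [ContinuousMultilinearMap.compContinuousLinearMap_apply]
  congr 1
  ext j
  fin_cases j <;> simp

lemma laplacian_comp_sub_left (u : E → ℂ) (b x : E) :
    (Δ fun y => u (b - y)) x = (Δ u) (b - x) := by
  simpa [neg_add_eq_sub] using laplacian_comp_isometry_add u (LinearIsometryEquiv.neg ℝ) b x

lemma laplacian_comp_add_right (u : E → ℂ) (b x : E) :
    (Δ fun y => u (y + b)) x = (Δ u) (x + b) := by
  simpa using laplacian_comp_isometry_add u (LinearIsometryEquiv.refl ℝ E) b x

lemma continuous_divergence {W : E → E →L[ℝ] ℂ} (hW : ContDiff ℝ 1 W) :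
    Continuous (divergence W) := by
  have := hW.continuous_fderiv one_ne_zero
  unfold divergence
  fun_prop

lemma hasCompactSupport_divergence {W : E → E →L[ℝ] ℂ} (hW : HasCompactSupport W) :
    HasCompactSupport (divergence W) :=
  (hW.fderiv (𝕜 := ℝ)).mono fun x hx h => hx (by simp [divergence, h])

lemma continuous_laplacian {u : E → ℂ} (hu : ContDiff ℝ 2 u) : Continuous (Δ u) :=
  laplacian_eq_divergence_fderiv u ▸
    continuous_divergence (hu.fderiv_right (m := 1) (by norm_num))

lemma hasCompactSupport_laplacian {u : E → ℂ} (hu : HasCompactSupport u) :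
    HasCompactSupport (Δ u) :=
  laplacian_eq_divergence_fderiv u ▸ hasCompactSupport_divergence (hu.fderiv (𝕜 := ℝ))

lemma divergence_smul {φ : E → ℂ} {W : E → E →L[ℝ] ℂ} {x : E} (hφ : DifferentiableAt ℝ φ x)
    (hW : DifferentiableAt ℝ W x) :
    divergence (fun y => φ y • W y) x = φ x * divergence W x + dot (fderiv ℝ φ x) (W x) := by
  simp only [divergence, dot, fderiv_fun_smul hφ hW, Finset.mul_sum, ← Finset.sum_add_distrib]
  simp

lemma divergence_sub {W X : E → E →L[ℝ] ℂ} {x : E} (hW : DifferentiableAt ℝ W x)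
    (hX : DifferentiableAt ℝ X x) :
    divergence (fun y => W y - X y) x = divergence W x - divergence X x := by
  simp [divergence, fderiv_fun_sub hW hX]

lemma divergence_greenCurrent {u v : E → ℂ} (hu : ContDiff ℝ 2 u) (hv : ContDiff ℝ 2 v) (x : E) :
    divergence (greenCurrent u v) x = v x * (Δ u) x - u x * (Δ v) x := by
  have hdu : DifferentiableAt ℝ u x := hu.differentiable two_ne_zero x
  have hdv : DifferentiableAt ℝ v x := hv.differentiable two_ne_zero x
  have hdu' : DifferentiableAt ℝ (fderiv ℝ u) x :=
    (hu.fderiv_right (m := 1) (by norm_num)).differentiable one_ne_zero x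
  have hdv' : DifferentiableAt ℝ (fderiv ℝ v) x :=
    (hv.fderiv_right (m := 1) (by norm_num)).differentiable one_ne_zero x
  unfold greenCurrent
  rw [divergence_sub (hdv.fun_smul hdu') (hdu.fun_smul hdv'), divergence_smul hdv hdu',
    divergence_smul hdu hdv', dot_comm (fderiv ℝ u x), laplacian_eq_divergence_fderiv,
    laplacian_eq_divergence_fderiv]
  ring

variable [MeasurableSpace E] [BorelSpace E]

lemma integral_divergence_eq_zero {W : E → E →L[ℝ] ℂ} (hW : ContDiff ℝ 1 W)
    (hc : HasCompactSupport W) : ∫ x, divergence W x = 0 := by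
  have hW' : Continuous (fderiv ℝ W) := hW.continuous_fderiv one_ne_zero
  have hint (a b : E) : Integrable fun x => fderiv ℝ W x a b :=
    (by fun_prop : Continuous fun x => fderiv ℝ W x a b).integrable_of_hasCompactSupport
      ((hc.fderiv (𝕜 := ℝ)).mono fun x hx h => hx (by simp [h]))
  have hzero (a b : E) : ∫ x, fderiv ℝ W x a b = 0 := by
    have hWb (x : E) : fderiv ℝ (fun y => W y b) x a = fderiv ℝ W x a b := by
      simp [fderiv_clm_apply (hW.differentiable one_ne_zero x) (differentiableAt_const b)]
    have hWbc : Integrable fun x => W x b :=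
      (hW.continuous.clm_apply continuous_const).integrable_of_hasCompactSupport
        (hc.mono fun x hx h => hx (by simp [h]))
    have hparts := integral_mul_fderiv_eq_neg_fderiv_mul_of_integrable (μ := volume) (𝕜 := ℂ)
      (f := fun _ => 1) (g := fun x => W x b) (v := a) (by simp) (by simp [hWb, hint])
      (by simpa using hWbc) (fun x _ => differentiableAt_const _)
      (fun x _ => (hW.differentiable one_ne_zero x).clm_apply (differentiableAt_const b))
    simpa [hWb] using hparts
  unfold divergence
  rw [integral_finsetSum _ fun i _ => hint _ _]
  exact Finset.sum_eq_zero fun i _ => hzero _ _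

lemma integral_mul_divergence {φ : E → ℂ} {W : E → E →L[ℝ] ℂ} (hφ : ContDiff ℝ 1 φ)
    (hc : HasCompactSupport φ) (hW : ContDiff ℝ 1 W) :
    ∫ x, φ x * divergence W x = - ∫ x, dot (fderiv ℝ φ x) (W x) := by
  have hzero : ∫ x, divergence (fun y => φ y • W y) x = 0 :=
    integral_divergence_eq_zero (hφ.smul hW) (hc.mono fun x hx h => hx (by ext; simp [h]))
  simp only [divergence_smul (hφ.differentiable one_ne_zero _) (hW.differentiable one_ne_zero _)]
    at hzero
  rw [integral_add] at hzero
  · exact eq_neg_of_add_eq_zero_left hzero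
  · exact (hφ.continuous.mul (continuous_divergence hW)).integrable_of_hasCompactSupport
      hc.mul_right
  · exact (continuous_dot (hφ.continuous_fderiv one_ne_zero)
      hW.continuous).integrable_of_hasCompactSupport
      ((hc.fderiv (𝕜 := ℝ)).mono fun x hx h => hx (by simp [dot, h]))

lemma integral_laplacian_mul {u η : E → ℂ} (hu : ContDiff ℝ 2 u) (hη : ContDiff ℝ 2 η)
    (hc : HasCompactSupport η) : ∫ x, (Δ u) x * η x = ∫ x, u x * (Δ η) x := by
  have hcurrent : HasCompactSupport (greenCurrent u η) :=
    (hc.smul_right (f' := fderiv ℝ u)).sub ((hc.fderiv (𝕜 := ℝ)).smul_left (f := u))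
  have hzero := integral_divergence_eq_zero (contDiff_greenCurrent hu hη) hcurrent
  simp only [divergence_greenCurrent hu hη] at hzero
  rw [integral_sub] at hzero
  · simpa only [mul_comm] using sub_eq_zero.1 hzero
  · exact (hη.continuous.mul (continuous_laplacian hu)).integrable_of_hasCompactSupport
      hc.mul_right
  · exact (hu.continuous.mul (continuous_laplacian hη)).integrable_of_hasCompactSupport
      (hasCompactSupport_laplacian hc).mul_left

end Green

end VectorCalculus

/-! ### Far fields -/

section FarField

variable {E : Type*} [NormedAddCommGroup E] [InnerProductSpace ℝ E]

/-- The phase factor `e^{iθ}` of a real angle. -/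
noncomputable def phase (θ : ℝ) : ℂ := Complex.exp (Complex.I * θ)

lemma norm_phase (θ : ℝ) : ‖phase θ‖ = 1 := by
  rw [phase, mul_comm]
  exact Complex.norm_exp_ofReal_mul_I θ

lemma phase_zero : phase 0 = 1 := by simp [phase]

lemma phase_add (a b : ℝ) : phase (a + b) = phase a * phase b := by
  simp [phase, mul_add, Complex.exp_add]

lemma phase_neg_mul_phase (a : ℝ) : phase (-a) * phase a = 1 := by
  rw [← phase_add, neg_add_cancel, phase_zero]

lemma contDiff_phase {n : WithTop ℕ∞} : ContDiff ℝ n phase :=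
  (contDiff_const.mul Complex.ofRealCLM.contDiff).cexp

@[fun_prop]
lemma continuous_phase : Continuous phase := contDiff_phase (n := 0).continuous

lemma hasDerivAt_phase (θ : ℝ) : HasDerivAt phase (Complex.I * phase θ) θ := by
  have h : HasDerivAt (fun t : ℝ => Complex.I * (t : ℂ)) Complex.I θ := by
    simpa using (hasDerivAt_id θ).ofReal_comp.const_mul Complex.I
  simpa only [mul_comm] using! h.cexp

lemma norm_phase_sub_phase_le (a b : ℝ) : ‖phase a - phase b‖ ≤ |a - b| := by
  have hfactor : phase a - phase b = phase b * (phase (a - b) - 1) := by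
    rw [mul_sub, ← phase_add, add_sub_cancel, mul_one]
  rw [hfactor, norm_mul, norm_phase, one_mul]
  simpa [phase] using Real.norm_exp_I_mul_ofReal_sub_one_le (x := a - b)

section Normalize

lemma normalize_mem_sphere {x : E} (hx : x ≠ 0) : normalize x ∈ Metric.sphere (0 : E) 1 :=
  mem_sphere_zero_iff_norm.2 (norm_normalize hx)

lemma norm_inner_normalize_le (x y : E) : ‖inner ℝ (normalize x) y‖ ≤ ‖y‖ := by
  rcases eq_or_ne x 0 with rfl | hx
  · simp
  · simpa [norm_normalize hx] using norm_inner_le_norm (𝕜 := ℝ) (normalize x) y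

/-- The upper bound is `‖x + y‖ ≤ (‖x + y‖² + ‖x‖²) / (2‖x‖)`. -/
lemma norm_add_sub_sub_inner_mem_Icc {x : E} (hx : x ≠ 0) (y : E) :
    ‖x + y‖ - (‖x‖ + inner ℝ (normalize x) y) ∈ Set.Icc 0 (‖y‖ ^ 2 / (2 * ‖x‖)) := by
  have hx' : 0 < ‖x‖ := norm_pos_iff.2 hx
  have hself : inner ℝ (normalize x) x = ‖x‖ := by
    simp [NormedSpace.normalize, real_inner_smul_left, pow_two, hx'.ne']
  have hxy : inner ℝ x y = ‖x‖ * inner ℝ (normalize x) y := by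
    rw [← real_inner_smul_left, norm_smul_normalize]
  constructor
  · have := real_inner_le_norm (normalize x) (x + y)
    rw [norm_normalize hx, inner_add_right, hself] at this
    linarith
  · have hsq := norm_add_sq_real x y
    rw [hxy] at hsq
    rw [le_div_iff₀ (by positivity)]
    nlinarith [sq_nonneg (‖x + y‖ - ‖x‖)]

lemma norm_normalize_add_sub_normalize_le {x : E} (hx : x ≠ 0) (y : E) :
    ‖normalize (x + y) - normalize x‖ ≤ 2 * ‖y‖ / ‖x‖ := by
  have hx' : 0 < ‖x‖ := norm_pos_iff.2 hx
  have hle : ‖normalize (x + y)‖ ≤ 1 := by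
    rcases eq_or_ne (x + y) 0 with h | h
    · simp [h]
    · exact (norm_normalize h).le
  have hsplit : normalize (x + y) - normalize x =
      ‖x‖⁻¹ • ((‖x‖ - ‖x + y‖) • normalize (x + y) + y) := by
    rw [sub_smul, norm_smul_normalize, sub_add, add_sub_cancel_right, smul_sub, smul_smul,
      inv_mul_cancel₀ hx'.ne', one_smul]
    rfl
  have hnorm : |‖x‖ - ‖x + y‖| ≤ ‖y‖ := by
    simpa using abs_norm_sub_norm_le x (x + y)
  rw [hsplit, norm_smul, norm_inv, norm_norm, inv_mul_eq_div]
  gcongr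
  calc ‖(‖x‖ - ‖x + y‖) • normalize (x + y) + y‖
      ≤ |‖x‖ - ‖x + y‖| * ‖normalize (x + y)‖ + ‖y‖ := by
        rw [← Real.norm_eq_abs, ← norm_smul]
        exact norm_add_le _ _
    _ ≤ ‖y‖ * 1 + ‖y‖ := by gcongr
    _ = 2 * ‖y‖ := by ring

end Normalize

section CoboundedLimits

variable {G : Type*} [NormedAddCommGroup G]

instance isCountablyGenerated_cobounded : (cobounded G).IsCountablyGenerated :=
  comap_norm_atTop (E := G) ▸ inferInstance

lemma tendsto_div_norm_cobounded (c : ℝ) :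
    Tendsto (fun x : G => c / ‖x‖) (cobounded G) (𝓝 0) :=
  tendsto_const_nhds.div_atTop tendsto_norm_cobounded_atTop

lemma exists_forall_norm_le_of_eventually [ProperSpace G] {F : Type*} [NormedAddCommGroup F]
    {f : G → F} {C : ℝ} (hf : Continuous f) (hC : ∀ᶠ x in cobounded G, ‖f x‖ ≤ C) :
    ∃ D, ∀ x, ‖f x‖ ≤ D := by
  obtain ⟨r, -, hr⟩ := (Metric.hasBasis_cobounded_compl_closedBall (0 : G)).eventually_iff.1 hC
  obtain ⟨D, hD⟩ := (isCompact_closedBall (0 : G) r).exists_bound_of_continuousOn hf.continuousOn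
  refine ⟨max C D, fun x => ?_⟩
  by_cases hx : x ∈ Metric.closedBall 0 r
  · exact (hD x hx).trans (le_max_right _ _)
  · exact (hr hx).trans (le_max_left _ _)

end CoboundedLimits

lemma tendsto_normalize_add_sub_normalize (y : E) :
    Tendsto (fun x : E => ‖normalize (x + y) - normalize x‖) (cobounded E) (𝓝 0) := by
  refine squeeze_zero' (Eventually.of_forall fun _ => norm_nonneg _) ?_
    (tendsto_div_norm_cobounded (2 * ‖y‖))
  filter_upwards [eventually_ne_cobounded 0] with x hx
  exact norm_normalize_add_sub_normalize_le hx y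

lemma tendsto_norm_add_sub_sub_inner (y : E) :
    Tendsto (fun x : E => ‖x + y‖ - (‖x‖ + inner ℝ (normalize x) y)) (cobounded E) (𝓝 0) := by
  refine squeeze_zero' (g := fun x => ‖y‖ ^ 2 / 2 / ‖x‖) ?_ ?_ (tendsto_div_norm_cobounded _)
  all_goals
    filter_upwards [eventually_ne_cobounded 0] with x hx
    have := norm_add_sub_sub_inner_mem_Icc hx y
  · exact this.1
  · simpa only [div_div] using this.2

lemma norm_mul_comp_add_le {G : Type*} [NormedAddCommGroup G] {u : G → ℂ} {D : ℝ}
    (hD : ∀ x, (1 + ‖x‖) * ‖u x‖ ≤ D) (x y : G) : ‖(‖x‖ : ℂ) * u (x + y)‖ ≤ (1 + ‖y‖) * D := by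
  have hxy : ‖x‖ ≤ (1 + ‖y‖) * (1 + ‖x + y‖) := by
    have := norm_sub_le (x + y) y
    rw [add_sub_cancel_right] at this
    nlinarith [norm_nonneg y, norm_nonneg (x + y)]
  calc ‖(‖x‖ : ℂ) * u (x + y)‖ = ‖x‖ * ‖u (x + y)‖ := by simp
    _ ≤ (1 + ‖y‖) * (1 + ‖x + y‖) * ‖u (x + y)‖ := by gcongr
    _ ≤ (1 + ‖y‖) * D := by
      rw [mul_assoc]
      gcongr
      exact hD _

/-- `u` is continuous and behaves at infinity like the outgoing wave `e^{iκ‖x‖} / ‖x‖ · F(x/‖x‖)`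
up to `o(1/‖x‖)`, with an amplitude `F` that is continuous on the unit sphere. -/
structure HasFarField (κ : ℝ) (u F : E → ℂ) : Prop where
  continuous : Continuous u
  continuousOn : ContinuousOn F (Metric.sphere 0 1)
  asymptotics : Tendsto (fun x => (‖x‖ : ℂ) * u x - phase (κ * ‖x‖) * F (normalize x))
    (cobounded E) (𝓝 0)

namespace HasFarField

variable [FiniteDimensional ℝ E] {κ : ℝ} {u F : E → ℂ}

lemma exists_amplitude_bound (h : HasFarField κ u F) :
    ∃ B, ∀ n ∈ Metric.sphere (0 : E) 1, ‖F n‖ ≤ B :=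
  (isCompact_sphere (0 : E) 1).exists_bound_of_continuousOn h.continuousOn

lemma exists_decay (h : HasFarField κ u F) : ∃ D, ∀ x, (1 + ‖x‖) * ‖u x‖ ≤ D := by
  obtain ⟨B, hF⟩ := h.exists_amplitude_bound
  have hfar : ∀ᶠ x in cobounded E, ‖((1 + ‖x‖ : ℝ) : ℂ) * u x‖ ≤ 2 * (1 + B) := by
    filter_upwards [eventually_ne_cobounded 0,
      tendsto_norm_cobounded_atTop.eventually_ge_atTop 1,
      h.asymptotics.norm.eventually_le_const (by simp : ‖(0 : ℂ)‖ < 1)] with x hx hx1 hu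
    have hB : ‖phase (κ * ‖x‖) * F (normalize x)‖ ≤ B := by
      simpa [norm_phase] using hF _ (normalize_mem_sphere hx)
    have hxu : ‖x‖ * ‖u x‖ ≤ 1 + B := by
      simpa using (norm_le_norm_sub_add _ _).trans (add_le_add hu hB)
    rw [norm_mul, Complex.norm_real, Real.norm_of_nonneg (by positivity)]
    nlinarith [norm_nonneg (u x)]
  have hcont : Continuous fun x => ((1 + ‖x‖ : ℝ) : ℂ) * u x := by
    have := h.continuous
    fun_prop
  obtain ⟨D, hD⟩ := exists_forall_norm_le_of_eventually hcont hfar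
  refine ⟨D, fun x => ?_⟩
  simpa [abs_of_nonneg (add_nonneg zero_le_one (norm_nonneg x)), ← Complex.ofReal_one,
    ← Complex.ofReal_add] using hD x

lemma exists_bound (h : HasFarField κ u F) : ∃ D, ∀ x, ‖u x‖ ≤ D := by
  obtain ⟨D, hD⟩ := h.exists_decay
  exact ⟨D, fun x => le_trans (by nlinarith [norm_nonneg x, norm_nonneg (u x)]) (hD x)⟩

lemma tendsto_zero (h : HasFarField κ u F) : Tendsto u (cobounded E) (𝓝 0) := by
  obtain ⟨D, hD⟩ := h.exists_decay
  refine squeeze_zero_norm' ?_ (tendsto_div_norm_cobounded D)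
  filter_upwards [eventually_ne_cobounded 0] with x hx
  rw [le_div_iff₀ (norm_pos_iff.2 hx)]
  nlinarith [hD x, norm_nonneg (u x)]

lemma tendsto_amplitude_normalize_add_sub (h : HasFarField κ u F) (y : E) :
    Tendsto (fun x => F (normalize (x + y)) - F (normalize x)) (cobounded E) (𝓝 0) := by
  have hunif := Metric.uniformContinuousOn_iff.1
    ((isCompact_sphere (0 : E) 1).uniformContinuousOn_of_continuous h.continuousOn)
  refine Metric.tendsto_nhds.2 fun ε hε => ?_
  obtain ⟨δ, hδ, hF⟩ := hunif ε hε
  filter_upwards [eventually_ne_cobounded 0,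
    (tendsto_add_const_cobounded y).eventually_ne_cobounded 0,
    (tendsto_normalize_add_sub_normalize y).eventually_lt_const hδ] with x hx hxy hclose
  simpa [dist_eq_norm] using
    hF _ (normalize_mem_sphere hxy) _ (normalize_mem_sphere hx) (by rwa [dist_eq_norm])

/-- Seen from far away in the direction `n`, a translation by `y` shortens the path by `n · y`. -/
lemma comp_add (h : HasFarField κ u F) (y : E) :
    HasFarField κ (fun x => u (x + y)) (fun n => F n * phase (κ * inner ℝ n y)) where
  continuous := h.continuous.comp (by fun_prop)
  continuousOn := h.continuousOn.mul (by fun_prop)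
  asymptotics := by
    obtain ⟨B, hF⟩ := h.exists_amplitude_bound
    have hshift := tendsto_add_const_cobounded (R := E) y
    have hradius : Tendsto (fun x => ((‖x‖ - ‖x + y‖ : ℝ) : ℂ) * u (x + y)) (cobounded E)
        (𝓝 0) := by
      refine squeeze_zero_norm (fun x => ?_)
        (by simpa using (h.tendsto_zero.comp hshift).norm.const_mul ‖y‖)
      rw [norm_mul, Complex.norm_real]
      gcongr
      simpa using abs_norm_sub_norm_le x (x + y)
    have hamplitude : Tendsto
        (fun x => phase (κ * ‖x + y‖) * (F (normalize (x + y)) - F (normalize x)))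
        (cobounded E) (𝓝 0) := by
      refine squeeze_zero_norm (fun x => ?_)
        (by simpa using (h.tendsto_amplitude_normalize_add_sub y).norm)
      simp [norm_phase]
    have hphase : Tendsto (fun x => (phase (κ * ‖x + y‖) -
        phase (κ * (‖x‖ + inner ℝ (normalize x) y))) * F (normalize x)) (cobounded E) (𝓝 0) := by
      refine squeeze_zero_norm' ?_
        (by simpa using ((tendsto_norm_add_sub_sub_inner y).const_mul κ).norm.mul_const B)
      filter_upwards [eventually_ne_cobounded 0] with x hx
      rw [norm_mul, ← abs_mul, mul_sub]
      gcongr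
      · exact norm_phase_sub_phase_le _ _
      · exact hF _ (normalize_mem_sphere hx)
    have hsum := ((hradius.add (h.asymptotics.comp hshift)).add hamplitude).add hphase
    simp only [add_zero] at hsum
    refine hsum.congr fun x => ?_
    simp only [Function.comp_apply, mul_add κ ‖x‖, phase_add, Complex.ofReal_sub]
    ring

variable [MeasurableSpace E] [BorelSpace E]

lemma average (h : HasFarField κ u F) {w : E → ℂ} (hw : Continuous w) (hc : HasCompactSupport w) :
    Tendsto (fun x => (‖x‖ : ℂ) * (∫ y, u (x + y) * w y) -
      phase (κ * ‖x‖) * (F (normalize x) * ∫ y, phase (κ * inner ℝ (normalize x) y) * w y))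
      (cobounded E) (𝓝 0) := by
  obtain ⟨B, hF⟩ := h.exists_amplitude_bound
  obtain ⟨D, hD⟩ := h.exists_decay
  have hu := h.continuous
  have hint {g : E → ℂ} (hg : Continuous g) : Integrable fun y => g y * w y :=
    (hg.mul hw).integrable_of_hasCompactSupport hc.mul_left
  have hpoint (y : E) : Tendsto (fun x => ((‖x‖ : ℂ) * u (x + y) - phase (κ * ‖x‖) *
      (F (normalize x) * phase (κ * inner ℝ (normalize x) y))) * w y) (cobounded E) (𝓝 0) := by
    simpa using (h.comp_add y).asymptotics.mul_const (w y)
  have hlimit := tendsto_integral_filter_of_dominated_convergence (μ := volume)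
    (bound := fun y => ((1 + ‖y‖) * D + B) * ‖w y‖)
    (Eventually.of_forall fun x => by fun_prop) ?_ ?_ (ae_of_all _ hpoint)
  · rw [integral_zero] at hlimit
    refine hlimit.congr fun x => ?_
    simp only [sub_mul, mul_assoc]
    rw [integral_sub, integral_const_mul, integral_const_mul, integral_const_mul]
    · exact (hint (by fun_prop)).const_mul _
    · exact ((hint (by fun_prop)).const_mul _).const_mul _
  · filter_upwards [eventually_ne_cobounded 0] with x hx
    refine ae_of_all _ fun y => ?_
    rw [norm_mul]
    gcongr
    refine (norm_sub_le _ _).trans (add_le_add ?_ ?_)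
    · exact norm_mul_comp_add_le hD x y
    · simpa [norm_phase] using hF _ (normalize_mem_sphere hx)
  · exact (by fun_prop : Continuous fun y => ((1 + ‖y‖) * D + B) * ‖w y‖)
      |>.integrable_of_hasCompactSupport hc.norm.mul_left

end HasFarField

end FarField

/-! ### Weak solutions of the Helmholtz equation -/

section WeakSolutions

variable {E : Type*} [NormedAddCommGroup E] [InnerProductSpace ℝ E] [FiniteDimensional ℝ E]
  [MeasurableSpace E] [BorelSpace E]

section Convolution

/-- Convolution of complex functions. -/
noncomputable def conv (f w : E → ℂ) : E → ℂ :=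
  convolution f w (ContinuousLinearMap.mul ℝ ℂ) volume

variable {f w : E → ℂ}

lemma conv_apply (f w : E → ℂ) (x : E) : conv f w x = ∫ t, f t * w (x - t) := rfl

lemma conv_swap (f w : E → ℂ) (x : E) : conv f w x = ∫ t, f (x - t) * w t :=
  convolution_eq_swap _

lemma conv_eq_integral_add (f w : E → ℂ) (x : E) :
    conv f w x = ∫ t, f (x + t) * w (-t) := by
  rw [conv_swap, ← integral_neg_eq_self]
  simp only [sub_neg_eq_add]

lemma integrable_conv (hf : Integrable f) (hw : Integrable w) : Integrable (conv f w) :=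
  hf.integrable_convolution _ hw

lemma integrable_mul_comp_sub (hf : LocallyIntegrable f) (hw : Continuous w)
    (hc : HasCompactSupport w) (x : E) : Integrable fun t => f t * w (x - t) :=
  hc.convolutionExists_right (ContinuousLinearMap.mul ℝ ℂ) hf hw x

lemma contDiff_conv (hf : LocallyIntegrable f) {n : ℕ∞} (hw : ContDiff ℝ n w)
    (hc : HasCompactSupport w) : ContDiff ℝ n (conv f w) :=
  hc.contDiff_convolution_right _ hf hw

lemma fderiv_conv (hf : LocallyIntegrable f) (hw : ContDiff ℝ 1 w) (hc : HasCompactSupport w)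
    (x a : E) : fderiv ℝ (conv f w) x a = conv f (fun y => fderiv ℝ w y a) x := by
  rw [conv, (hc.hasFDerivAt_convolution_right _ hf hw x).fderiv,
    convolution_precompR_apply _ hf (hc.fderiv (𝕜 := ℝ)) (hw.continuous_fderiv one_ne_zero)]
  rfl

lemma laplacian_conv (hf : LocallyIntegrable f) (hw : ContDiff ℝ 2 w) (hc : HasCompactSupport w)
    (x : E) : (Δ (conv f w)) x = conv f (Δ w) x := by
  have hw' (a : E) : ContDiff ℝ 1 fun y => fderiv ℝ w y a :=
    (hw.fderiv_right (by norm_num)).clm_apply contDiff_const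
  rw [laplacian_eq_sum_fderiv (contDiff_conv hf (n := 2) hw hc),
    funext (laplacian_eq_sum_fderiv hw)]
  simp only [fderiv_conv hf (hw.of_le one_le_two) hc,
    fderiv_conv hf (hw' _) (hc.fderiv_apply (𝕜 := ℝ) _)]
  simp only [conv_apply, Finset.mul_sum]
  exact (integral_finsetSum _ fun i _ => integrable_mul_comp_sub hf
    (((hw' _).continuous_fderiv one_ne_zero).clm_apply continuous_const)
    ((hc.fderiv_apply (𝕜 := ℝ) _).fderiv_apply (𝕜 := ℝ) _) x).symm

lemma integral_conv_mul (hf : Integrable f) (hw : Integrable w) (heven : ∀ x, w (-x) = w x)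
    {v : E → ℂ} (hv : Continuous v) {B : ℝ} (hB : ∀ x, ‖v x‖ ≤ B) :
    ∫ x, conv f w x * v x = ∫ x, f x * conv v w x := by
  have hint : Integrable (fun p : E × E => f p.2 * w (p.1 - p.2) * v p.1)
      (volume.prod volume) :=
    (hf.convolution_integrand (ContinuousLinearMap.mul ℝ ℂ) hw).mul_bdd (c := B)
      (hv.comp continuous_fst).aestronglyMeasurable (ae_of_all _ fun p => hB _)
  simp only [conv_apply, ← integral_const_mul, ← integral_mul_const]
  rw [integral_integral_swap hint]
  refine integral_congr_ae (ae_of_all _ fun y => integral_congr_ae (ae_of_all _ fun x => ?_))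
  simp only [← heven (x - y), neg_sub]
  ring

end Convolution

section Mollifier

/-- The mollifier given by a normalized smooth bump, as a complex function. -/
noncomputable def kernel (ρ : ContDiffBump (0 : E)) (x : E) : ℂ := ρ.normed volume x

lemma contDiff_kernel (ρ : ContDiffBump (0 : E)) {n : ℕ∞} : ContDiff ℝ n (kernel ρ) :=
  Complex.ofRealCLM.contDiff.comp ρ.contDiff_normed

lemma continuous_kernel (ρ : ContDiffBump (0 : E)) : Continuous (kernel ρ) :=
  (contDiff_kernel ρ (n := 0)).continuous

lemma hasCompactSupport_kernel (ρ : ContDiffBump (0 : E)) : HasCompactSupport (kernel ρ) :=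
  ρ.hasCompactSupport_normed.comp_left Complex.ofReal_zero

lemma integrable_kernel (ρ : ContDiffBump (0 : E)) : Integrable (kernel ρ) :=
  (continuous_kernel ρ).integrable_of_hasCompactSupport (hasCompactSupport_kernel ρ)

lemma kernel_neg (ρ : ContDiffBump (0 : E)) (x : E) : kernel ρ (-x) = kernel ρ x := by
  simp [kernel, ρ.normed_neg]

lemma norm_conv_kernel_le (ρ : ContDiffBump (0 : E)) {v : E → ℂ} {B : ℝ} (hB : ∀ x, ‖v x‖ ≤ B)
    (x : E) : ‖conv v (kernel ρ) x‖ ≤ B := by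
  rw [conv_swap]
  calc _ ≤ ∫ t, B * ρ.normed volume t := by
        refine norm_integral_le_of_norm_le (ρ.integrable_normed.const_mul _)
          (ae_of_all _ fun t => ?_)
        rw [norm_mul, kernel, Complex.norm_real, Real.norm_of_nonneg (ρ.nonneg_normed _)]
        exact mul_le_mul_of_nonneg_right (hB _) (ρ.nonneg_normed _)
    _ = B := by rw [integral_const_mul, ρ.integral_normed, mul_one]

lemma tendsto_conv_kernel {ι : Type*} {l : Filter ι} {ρ : ι → ContDiffBump (0 : E)}
    (hρ : Tendsto (fun i => (ρ i).rOut) l (𝓝 0)) {v : ι → E → ℂ} (hv : ∀ i, Continuous (v i))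
    {a : ι → E} {x : E} {z : ℂ} (hlim : Tendsto (Function.uncurry v) (l ×ˢ 𝓝 x) (𝓝 z))
    (ha : Tendsto a l (𝓝 x)) : Tendsto (fun i => conv (v i) (kernel (ρ i)) (a i)) l (𝓝 z) := by
  refine (ContDiffBump.convolution_tendsto_right (μ := volume) hρ
    (Eventually.of_forall fun i => (hv i).aestronglyMeasurable) hlim ha).congr fun i => ?_
  simp [conv_swap, convolution_def, kernel, mul_comm]

lemma tendsto_conv_kernel_conv_kernel {ρ : ℕ → ContDiffBump (0 : E)}
    (hρ : Tendsto (fun n => (ρ n).rOut) atTop (𝓝 0)) {v : E → ℂ} (hv : Continuous v) (x : E) :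
    Tendsto (fun n => conv (conv v (kernel (ρ n))) (kernel (ρ n)) x) atTop (𝓝 (v x)) := by
  refine tendsto_conv_kernel hρ (fun n => (contDiff_conv hv.locallyIntegrable (n := 0)
    (contDiff_kernel _) (hasCompactSupport_kernel _)).continuous) ?_ tendsto_const_nhds
  exact tendsto_conv_kernel (ρ := fun p : ℕ × E => ρ p.1) (v := fun _ => v) (a := Prod.snd)
    (hρ.comp tendsto_fst) (fun _ => hv) ((hv.tendsto x).comp tendsto_snd) tendsto_snd

lemma tendsto_integral_conv_kernel_mul_conv_kernel {ρ : ℕ → ContDiffBump (0 : E)}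
    (hρ : Tendsto (fun n => (ρ n).rOut) atTop (𝓝 0)) {s v : E → ℂ} (hs : Integrable s)
    (hv : Continuous v) {B : ℝ} (hB : ∀ x, ‖v x‖ ≤ B) :
    Tendsto (fun n => ∫ x, conv s (kernel (ρ n)) x * conv v (kernel (ρ n)) x) atTop
      (𝓝 (∫ x, s x * v x)) := by
  have hcont {g : E → ℂ} (hg : Continuous g) (n : ℕ) : Continuous (conv g (kernel (ρ n))) :=
    (contDiff_conv hg.locallyIntegrable (n := 0) (contDiff_kernel _)
      (hasCompactSupport_kernel _)).continuous
  have hbound (n : ℕ) := norm_conv_kernel_le (ρ n) hB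
  simp only [fun n => integral_conv_mul hs (integrable_kernel (ρ n)) (kernel_neg _) (hcont hv n)
    (hbound n)]
  refine tendsto_integral_of_dominated_convergence (fun x => ‖s x‖ * B) (fun n => ?_)
    (hs.norm.mul_const _) (fun n => ae_of_all _ fun x => ?_) (ae_of_all _ fun x => ?_)
  · exact hs.aestronglyMeasurable.mul (hcont (hcont hv n) n).aestronglyMeasurable
  · rw [norm_mul]
    gcongr
    exact norm_conv_kernel_le _ (hbound n) x
  · exact (tendsto_conv_kernel_conv_kernel hρ hv x).const_mul _

end Mollifier

section Helmholtz

/-- `(Δ + κ²) u = s` in the sense of distributions. -/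
def IsWeakHelmholtz (κ : ℝ) (u s : E → ℂ) : Prop :=
  ∀ η : E → ℂ, ContDiff ℝ ∞ η → HasCompactSupport η →
    ∫ x, s x * η x = ∫ x, u x * ((Δ η) x + (κ : ℂ) ^ 2 * η x)

namespace IsWeakHelmholtz

variable {κ : ℝ} {u v s t : E → ℂ}

lemma of_laplacian (hu : ContDiff ℝ 2 u) (h : ∀ x, (Δ u) x + (κ : ℂ) ^ 2 * u x = s x) :
    IsWeakHelmholtz κ u s := by
  intro η hη hc
  have hη2 : ContDiff ℝ 2 η := hη.of_le (by norm_cast)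
  have hleft : Integrable fun x => (Δ u) x * η x :=
    ((continuous_laplacian hu).mul hη.continuous).integrable_of_hasCompactSupport hc.mul_left
  have hright : Integrable fun x => u x * (Δ η) x :=
    (hu.continuous.mul (continuous_laplacian hη2)).integrable_of_hasCompactSupport
      (hasCompactSupport_laplacian hc).mul_left
  have hmass : Integrable fun x => u x * (κ : ℂ) ^ 2 * η x :=
    ((hu.continuous.mul continuous_const).mul hη.continuous).integrable_of_hasCompactSupport
      hc.mul_left
  have hsource : ∫ x, s x * η x = ∫ x, (Δ u) x * η x + u x * (κ : ℂ) ^ 2 * η x := by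
    refine integral_congr_ae (ae_of_all _ fun x => ?_)
    simp only [← h x]
    ring
  rw [hsource, integral_add hleft hmass, integral_laplacian_mul hu hη2 hc,
    ← integral_add hright hmass]
  exact integral_congr_ae (ae_of_all _ fun x => by ring)

lemma sub (hu : IsWeakHelmholtz κ u s) (hv : IsWeakHelmholtz κ v t) (huc : Continuous u)
    (hvc : Continuous v) (hs : LocallyIntegrable s) (ht : LocallyIntegrable t) :
    IsWeakHelmholtz κ (fun x => u x - v x) (fun x => s x - t x) := by
  intro η hη hc
  have hsource {g : E → ℂ} (hg : LocallyIntegrable g) : Integrable fun x => g x * η x := by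
    simpa only [smul_eq_mul, mul_comm] using
      hg.integrable_smul_left_of_hasCompactSupport hη.continuous hc
  have hfield {g : E → ℂ} (hg : Continuous g) :
      Integrable fun x => g x * ((Δ η) x + (κ : ℂ) ^ 2 * η x) :=
    (hg.mul ((continuous_laplacian (hη.of_le (by norm_cast))).add
      (continuous_const.mul hη.continuous))).integrable_of_hasCompactSupport
      ((hasCompactSupport_laplacian hc).add hc.mul_left).mul_left
  simp only [sub_mul]
  rw [integral_sub (hsource hs) (hsource ht), integral_sub (hfield huc) (hfield hvc), hu η hη hc,
    hv η hη hc]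

lemma comp_add (h : IsWeakHelmholtz κ u s) (b : E) :
    IsWeakHelmholtz κ (fun x => u (x + b)) (fun x => s (x + b)) := by
  intro η hη hc
  have hshift := h (fun x => η (x + -b)) (hη.comp (contDiff_id.add contDiff_const))
    (hc.comp_homeomorph (Homeomorph.addRight (-b)))
  rw [← integral_add_right_eq_self _ b, ← integral_add_right_eq_self (fun x => u x * _) b] at hshift
  simpa only [laplacian_comp_add_right, add_neg_cancel_right] using hshift

lemma laplacian_conv_add (h : IsWeakHelmholtz κ u s) (hu : LocallyIntegrable u) {w : E → ℂ}
    (hw : ContDiff ℝ ∞ w) (hc : HasCompactSupport w) (x : E) :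
    (Δ (conv u w)) x + (κ : ℂ) ^ 2 * conv u w x = conv s w x := by
  have hw2 : ContDiff ℝ 2 w := hw.of_le (by norm_cast)
  have htest := h (fun y => w (x - y)) (hw.comp (contDiff_const.sub contDiff_id))
    (hc.comp_homeomorph (Homeomorph.subLeft x))
  rw [laplacian_conv hu hw2 hc, conv_apply s, htest, conv_apply, conv_apply,
    ← integral_const_mul, ← integral_add]
  · refine integral_congr_ae (ae_of_all _ fun y => ?_)
    simp only [laplacian_comp_sub_left]
    ring
  · exact integrable_mul_comp_sub hu (continuous_laplacian hw2) (hasCompactSupport_laplacian hc) x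
  · exact (integrable_mul_comp_sub hu hw.continuous hc x).const_mul _

end IsWeakHelmholtz

end Helmholtz

end WeakSolutions

/-! ### Reciprocity of outgoing solutions -/

section OutgoingSolutions

variable {E : Type*} [NormedAddCommGroup E] [InnerProductSpace ℝ E]

section Radiation

lemma fderiv_phase_inner (κ : ℝ) (n y a : E) :
    fderiv ℝ (fun y => phase (κ * inner ℝ n y)) y a =
      Complex.I * (κ * inner ℝ n a : ℝ) * phase (κ * inner ℝ n y) := by
  have hangle : HasFDerivAt (fun y : E => κ * inner ℝ n y) (κ • innerSL ℝ n) y :=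
    (innerSL ℝ n).hasFDerivAt.const_mul κ
  have hcomp := ((hasDerivAt_phase _).hasFDerivAt.comp y hangle).fderiv
  rw [Function.comp_def] at hcomp
  rw [hcomp]
  simp
  ring

lemma contDiff_phase_inner (κ : ℝ) (n : E) {m : WithTop ℕ∞} :
    ContDiff ℝ m fun y : E => phase (κ * inner ℝ n y) :=
  contDiff_phase.comp (contDiff_const.mul (contDiff_const.inner ℝ contDiff_id))

/-- Sommerfeld's radiation condition: `u` is `O(1/‖x‖)`, and its gradient agrees with that of an
outgoing wave of wave number `κ` up to `o(1/‖x‖)`. -/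
structure IsSommerfeld (κ : ℝ) (u : E → ℂ) : Prop where
  contDiff : ContDiff ℝ 2 u
  decay : ∃ D, ∀ x, (1 + ‖x‖) * ‖u x‖ ≤ D
  radiation (a : E) : Tendsto (fun x => (‖x‖ : ℂ) *
    (fderiv ℝ u x a - Complex.I * (κ * inner ℝ (normalize x) a : ℝ) * u x)) (cobounded E) (𝓝 0)

lemma IsSommerfeld.tendsto_norm_sq_mul_greenCurrent {κ : ℝ} {u v : E → ℂ}
    (hu : IsSommerfeld κ u) (hv : IsSommerfeld κ v) (a : E) :
    Tendsto (fun x => (‖x‖ : ℂ) ^ 2 * greenCurrent u v x a) (cobounded E) (𝓝 0) := by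
  have hprod {f g : E → ℂ} (hf : IsSommerfeld κ f) (hg : IsSommerfeld κ g) :
      Tendsto (fun x => (‖x‖ : ℂ) * f x * ((‖x‖ : ℂ) *
        (fderiv ℝ g x a - Complex.I * (κ * inner ℝ (normalize x) a : ℝ) * g x)))
        (cobounded E) (𝓝 0) := by
    obtain ⟨D, hD⟩ := hf.decay
    refine squeeze_zero_norm (fun x => ?_)
      (by simpa only [norm_zero, mul_zero] using (hg.radiation a).norm.const_mul D)
    have hfx : ‖(‖x‖ : ℂ) * f x‖ ≤ D := by
      rw [norm_mul, Complex.norm_real, norm_norm]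
      nlinarith [hD x, norm_nonneg (f x)]
    rw [norm_mul]
    exact mul_le_mul_of_nonneg_right hfx (norm_nonneg _)
  have hdiff := (hprod hv hu).sub (hprod hu hv)
  rw [sub_zero] at hdiff
  refine hdiff.congr fun x => ?_
  simp [greenCurrent]
  ring

variable [FiniteDimensional ℝ E] [MeasurableSpace E] [BorelSpace E]

lemma integral_phase_inner_mul_fderiv {w : E → ℂ} (hw : ContDiff ℝ 1 w)
    (hc : HasCompactSupport w) (κ : ℝ) (n a : E) :
    ∫ y, phase (κ * inner ℝ n y) * fderiv ℝ w (-y) a =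
      Complex.I * (κ * inner ℝ n a : ℝ) * ∫ y, phase (κ * inner ℝ n y) * w (-y) := by
  have hphase : ContDiff ℝ 1 fun y => phase (κ * inner ℝ n y) := contDiff_phase_inner κ n
  have hw' : Continuous (fderiv ℝ w) := hw.continuous_fderiv one_ne_zero
  have hwc := hw.continuous
  have hcneg : HasCompactSupport fun y => w (-y) := hc.comp_homeomorph (Homeomorph.neg E)
  have hderiv (y : E) : fderiv ℝ (fun y => w (-y)) y a = -fderiv ℝ w (-y) a := by
    simpa using congrArg (· a) (fderiv_comp_smul (f := w) (x := y) (-1 : ℝ))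
  have hparts := integral_mul_fderiv_eq_neg_fderiv_mul_of_integrable (μ := volume) (𝕜 := ℂ)
    (f := fun y => phase (κ * inner ℝ n y)) (g := fun y => w (-y)) (v := a) ?_ ?_ ?_
    (fun y _ => hphase.differentiable one_ne_zero y)
    (fun y _ => (hw.comp contDiff_neg).differentiable one_ne_zero y)
  · simp only [hderiv, fderiv_phase_inner, mul_neg, integral_neg, neg_inj, mul_assoc] at hparts
    simpa only [integral_const_mul, mul_assoc] using hparts
  · simp only [fderiv_phase_inner]
    exact (by fun_prop : Continuous _).integrable_of_hasCompactSupport hcneg.mul_left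
  · simp only [hderiv]
    exact (by fun_prop : Continuous _).integrable_of_hasCompactSupport
      ((hc.fderiv_apply (𝕜 := ℝ) a).comp_homeomorph (Homeomorph.neg E)).neg.mul_left
  · exact (by fun_prop : Continuous _).integrable_of_hasCompactSupport hcneg.mul_left

lemma HasFarField.conv {κ : ℝ} {u F w : E → ℂ} (h : HasFarField κ u F) (hw : Continuous w)
    (hc : HasCompactSupport w) :
    HasFarField κ (conv u w) fun n => F n * ∫ y, phase (κ * inner ℝ n y) * w (-y) where
  continuous := (contDiff_conv h.continuous.locallyIntegrable (n := 0)
    (contDiff_zero.2 hw) hc).continuous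
  continuousOn := by
    have hcneg : HasCompactSupport fun y => w (-y) := hc.comp_homeomorph (Homeomorph.neg E)
    refine h.continuousOn.mul (Continuous.continuousOn ?_)
    refine continuous_of_dominated (bound := fun y => ‖w (-y)‖) (fun n => by fun_prop)
      (fun n => ae_of_all _ fun y => by simp [norm_phase])
      ((hw.comp continuous_neg).integrable_of_hasCompactSupport hcneg).norm
      (ae_of_all _ fun y => by fun_prop)
  asymptotics := by
    simp only [conv_eq_integral_add]
    exact h.average (hw.comp continuous_neg) (hc.comp_homeomorph (Homeomorph.neg E))

lemma HasFarField.isSommerfeld_conv {κ : ℝ} {u F w : E → ℂ} (h : HasFarField κ u F)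
    (hw : ContDiff ℝ 2 w) (hc : HasCompactSupport w) : IsSommerfeld κ (Scattering.conv u w) where
  contDiff := contDiff_conv h.continuous.locallyIntegrable (n := 2) hw hc
  decay := (h.conv hw.continuous hc).exists_decay
  radiation := fun a => by
    have hw1 : ContDiff ℝ 1 w := hw.of_le one_le_two
    have hgradient := (h.conv ((hw1.continuous_fderiv one_ne_zero).clm_apply continuous_const)
      (hc.fderiv_apply (𝕜 := ℝ) a)).asymptotics
    have hvalue : Tendsto (fun x => Complex.I * (κ * inner ℝ (NormedSpace.normalize x) a : ℝ) *
        ((‖x‖ : ℂ) * Scattering.conv u w x - phase (κ * ‖x‖) *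
          (F (normalize x) * ∫ y, phase (κ * inner ℝ (normalize x) y) * w (-y))))
        (cobounded E) (𝓝 0) := by
      refine squeeze_zero_norm (fun x => ?_)
        (by simpa using (h.conv hw.continuous hc).asymptotics.norm.const_mul (|κ| * ‖a‖))
      rw [norm_mul]
      gcongr
      simpa using mul_le_mul_of_nonneg_left (norm_inner_normalize_le x a) (abs_nonneg κ)
    have hdiff := hgradient.sub hvalue
    rw [sub_zero] at hdiff
    refine hdiff.congr fun x => ?_
    rw [fderiv_conv h.continuous.locallyIntegrable hw1 hc,
      integral_phase_inner_mul_fderiv hw1 hc]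
    ring

end Radiation

section Cutoff

/-- A smooth function equal to `1` on the ball of radius `R` and to `0` off the ball of radius
`2R`. -/
noncomputable def cutoff (R : ℝ) (x : E) : ℂ :=
  ((⟨1, 2, one_pos, one_lt_two⟩ : ContDiffBump (0 : E)) (R⁻¹ • x) : ℝ)

lemma contDiff_cutoff (R : ℝ) {n : ℕ∞} : ContDiff ℝ n (cutoff R : E → ℂ) :=
  Complex.ofRealCLM.contDiff.comp (ContDiffBump.contDiff _ |>.comp (contDiff_const_smul R⁻¹))

lemma norm_cutoff_le (R : ℝ) (x : E) : ‖cutoff R x‖ ≤ 1 := by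
  rw [cutoff, Complex.norm_real, Real.norm_of_nonneg (ContDiffBump.nonneg _)]
  exact ContDiffBump.le_one _

lemma cutoff_eq_one {R : ℝ} (hR : 0 < R) {x : E} (hx : ‖x‖ ≤ R) : cutoff R x = 1 := by
  rw [cutoff, ContDiffBump.one_of_mem_closedBall, Complex.ofReal_one]
  rwa [mem_closedBall_zero_iff, norm_smul, norm_inv, Real.norm_of_nonneg hR.le,
    inv_mul_le_iff₀ hR, mul_one]

lemma tendsto_cutoff (x : E) : Tendsto (fun R => cutoff R x) atTop (𝓝 1) := by
  refine tendsto_const_nhds.congr' ?_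
  filter_upwards [eventually_gt_atTop 0, eventually_ge_atTop ‖x‖] with R hR hx
  exact (cutoff_eq_one hR hx).symm

lemma fderiv_cutoff (R : ℝ) (x : E) :
    fderiv ℝ (cutoff R) x = R⁻¹ • fderiv ℝ (cutoff 1) (R⁻¹ • x) := by
  have hscale : (cutoff R : E → ℂ) = fun x => cutoff 1 (R⁻¹ • x) := by
    ext
    simp [cutoff]
  rw [hscale, fderiv_comp_smul]

lemma fderiv_cutoff_one_eq_zero {x : E} (hx : ‖x‖ < 1) : fderiv ℝ (cutoff 1) x = 0 := by
  have hconst : (cutoff 1 : E → ℂ) =ᶠ[𝓝 x] fun _ => 1 := by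
    filter_upwards [(isOpen_lt continuous_norm continuous_const).mem_nhds hx] with y hy
    exact cutoff_eq_one one_pos (le_of_lt hy)
  rw [hconst.fderiv_eq, fderiv_const_apply]

lemma norm_fderiv_cutoff_one_mul_le (g : E → ℂ) (a : E) (R : ℝ) (y : E) :
    ‖fderiv ℝ (cutoff 1) y a * ((R : ℂ) ^ 2 * g (R • y))‖ ≤
      ‖fderiv ℝ (cutoff 1) y a‖ * ‖(‖R • y‖ : ℂ) ^ 2 * g (R • y)‖ := by
  rcases lt_or_ge ‖y‖ 1 with hy | hy
  · simp [fderiv_cutoff_one_eq_zero hy]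
  · simp only [norm_mul, norm_pow, Complex.norm_real, norm_smul, norm_norm]
    gcongr
    exact le_mul_of_one_le_right (norm_nonneg R) hy

variable [FiniteDimensional ℝ E]

lemma hasCompactSupport_cutoff {R : ℝ} (hR : 0 < R) : HasCompactSupport (cutoff R : E → ℂ) :=
  ((ContDiffBump.hasCompactSupport _).comp_smul (inv_ne_zero hR.ne')).comp_left
    Complex.ofReal_zero

lemma tendsto_integral_cutoff_mul [MeasurableSpace E] [BorelSpace E] {f : E → ℂ}
    (hf : Integrable f) :
    Tendsto (fun R => ∫ x, cutoff R x * f x) atTop (𝓝 (∫ x, f x)) := by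
  refine tendsto_integral_filter_of_dominated_convergence (fun x => ‖f x‖)
    (Eventually.of_forall fun R => ?_) (Eventually.of_forall fun R => ae_of_all _ fun x => ?_)
    hf.norm (ae_of_all _ fun x => by simpa using (tendsto_cutoff x).mul_const (f x))
  · exact (contDiff_cutoff R (n := 0)).continuous.aestronglyMeasurable.mul hf.aestronglyMeasurable
  · rw [norm_mul]
    exact mul_le_of_le_one_left (norm_nonneg _) (norm_cutoff_le R x)

lemma integral_fderiv_cutoff_mul {R : ℝ} (hR : 0 < R) (g : Space3 → ℂ) (a : Space3) :
    ∫ x, fderiv ℝ (cutoff R) x a * g x =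
      ∫ y, fderiv ℝ (cutoff 1) y a * ((R : ℂ) ^ 2 * g (R • y)) := by
  have hscale := Measure.integral_comp_smul volume (fun x => fderiv ℝ (cutoff R) x a * g x) R
  have hfderiv_smul (y : Space3) :
      fderiv ℝ (cutoff R) (R • y) = R⁻¹ • fderiv ℝ (cutoff 1) y := by
    rw [fderiv_cutoff, smul_smul, inv_mul_cancel₀ hR.ne', one_smul]
  rw [finrank_euclideanSpace_fin, abs_of_pos (by positivity), eq_inv_smul_iff₀ (by positivity),
    ← integral_smul] at hscale
  rw [← hscale]
  refine integral_congr_ae (ae_of_all _ fun y => ?_)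
  simp only [hfderiv_smul, _root_.smul_apply, Complex.real_smul]
  push_cast
  field_simp

lemma tendsto_integral_fderiv_cutoff_mul {g : Space3 → ℂ} (hg : Continuous g)
    (hlim : Tendsto (fun x => (‖x‖ : ℂ) ^ 2 * g x) (cobounded Space3) (𝓝 0)) (a : Space3) :
    Tendsto (fun R => ∫ x, fderiv ℝ (cutoff R) x a * g x) atTop (𝓝 0) := by
  have hcutoff : ContDiff ℝ 1 (cutoff 1 : Space3 → ℂ) := contDiff_cutoff 1 (n := 1)
  have hfderiv : Continuous fun y : Space3 => fderiv ℝ (cutoff 1) y a :=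
    (hcutoff.continuous_fderiv one_ne_zero).clm_apply continuous_const
  obtain ⟨D, hD⟩ := exists_forall_norm_le_of_eventually (by fun_prop)
    (hlim.norm.eventually_le_const (by simp : ‖(0 : ℂ)‖ < 1))
  have hshell : Tendsto (fun R : ℝ => ∫ y : Space3, fderiv ℝ (cutoff 1) y a *
      ((R : ℂ) ^ 2 * g (R • y))) atTop (𝓝 (∫ _ : Space3, 0)) := by
    refine tendsto_integral_filter_of_dominated_convergence
      (fun y => ‖fderiv ℝ (cutoff 1) y a‖ * D)
      (Eventually.of_forall fun R => (by fun_prop : Continuous _).aestronglyMeasurable) ?_ ?_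
      (ae_of_all _ fun y => ?_)
    · exact Eventually.of_forall fun R => ae_of_all _ fun y =>
        (norm_fderiv_cutoff_one_mul_le g a R y).trans (by gcongr; exact hD _)
    · exact (hfderiv.integrable_of_hasCompactSupport
        ((hasCompactSupport_cutoff one_pos).fderiv_apply (𝕜 := ℝ) a)).norm.mul_const D
    · rcases eq_or_ne y 0 with rfl | hy
      · simp [fderiv_cutoff_one_eq_zero]
      · have hfar : Tendsto (fun R : ℝ => R • y) atTop (cobounded Space3) := by
          rw [← tendsto_norm_atTop_iff_cobounded]
          simp only [norm_smul]
          exact tendsto_norm_atTop_atTop.atTop_mul_const (norm_pos_iff.2 hy)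
        refine squeeze_zero_norm (fun R => norm_fderiv_cutoff_one_mul_le g a R y) ?_
        simpa using (hlim.comp hfar).norm.const_mul ‖fderiv ℝ (cutoff 1) y a‖
  rw [integral_zero] at hshell
  refine hshell.congr' ?_
  filter_upwards [eventually_gt_atTop 0] with R hR
  exact (integral_fderiv_cutoff_mul hR g a).symm

lemma tendsto_integral_dot_fderiv_cutoff {W : Space3 → Space3 →L[ℝ] ℂ} (hW : Continuous W)
    (hlim : ∀ a, Tendsto (fun x => (‖x‖ : ℂ) ^ 2 * W x a) (cobounded Space3) (𝓝 0)) :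
    Tendsto (fun R => ∫ x, dot (fderiv ℝ (cutoff R) x) (W x)) atTop (𝓝 0) := by
  have hsum := tendsto_finsetSum Finset.univ fun i _ => tendsto_integral_fderiv_cutoff_mul
    (hW.clm_apply continuous_const) (hlim (stdOrthonormalBasis ℝ Space3 i))
    (stdOrthonormalBasis ℝ Space3 i)
  rw [Finset.sum_const_zero] at hsum
  refine hsum.congr' ?_
  filter_upwards [eventually_gt_atTop 0] with R hR
  have hcutoff : ContDiff ℝ 1 (cutoff R : Space3 → ℂ) := contDiff_cutoff R (n := 1)
  refine (integral_finsetSum _ fun i _ => ?_).symm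
  exact (((hcutoff.continuous_fderiv one_ne_zero).clm_apply continuous_const).mul
    (hW.clm_apply continuous_const)).integrable_of_hasCompactSupport
    ((hasCompactSupport_cutoff hR).fderiv_apply (𝕜 := ℝ) _).mul_right

end Cutoff

section Reciprocity

lemma IsSommerfeld.reciprocity {κ : ℝ} {u v s t : Space3 → ℂ} (hu : IsSommerfeld κ u)
    (hv : IsSommerfeld κ v) (hs : Integrable s) (ht : Integrable t)
    (hus : ∀ x, (Δ u) x + (κ : ℂ) ^ 2 * u x = s x)
    (hvt : ∀ x, (Δ v) x + (κ : ℂ) ^ 2 * v x = t x) :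
    ∫ x, s x * v x = ∫ x, u x * t x := by
  have hbounded {f : Space3 → ℂ} (hf : IsSommerfeld κ f) : ∃ D, ∀ x, ‖f x‖ ≤ D := by
    obtain ⟨D, hD⟩ := hf.decay
    exact ⟨D, fun x => le_trans (by nlinarith [norm_nonneg x, norm_nonneg (f x)]) (hD x)⟩
  obtain ⟨Bu, hBu⟩ := hbounded hu
  obtain ⟨Bv, hBv⟩ := hbounded hv
  have hsv : Integrable fun x => s x * v x :=
    hs.mul_bdd (c := Bv) hv.contDiff.continuous.aestronglyMeasurable (ae_of_all _ hBv)
  have hut : Integrable fun x => u x * t x :=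
    ht.bdd_mul (c := Bu) hu.contDiff.continuous.aestronglyMeasurable (ae_of_all _ hBu)
  have hdiv (x : Space3) : divergence (greenCurrent u v) x = s x * v x - u x * t x := by
    rw [divergence_greenCurrent hu.contDiff hv.contDiff, ← hus, ← hvt]
    ring
  have hcurrent := contDiff_greenCurrent hu.contDiff hv.contDiff
  have hflux := (tendsto_integral_dot_fderiv_cutoff hcurrent.continuous
    (hu.tendsto_norm_sq_mul_greenCurrent hv)).neg
  rw [neg_zero] at hflux
  have hzero : ∫ x, s x * v x - u x * t x = 0 := by
    refine tendsto_nhds_unique (tendsto_integral_cutoff_mul (hsv.sub hut)) (hflux.congr' ?_)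
    filter_upwards [eventually_gt_atTop 0] with R hR
    rw [← integral_mul_divergence (contDiff_cutoff R (n := 1)) (hasCompactSupport_cutoff hR)
      hcurrent]
    simp only [hdiv]
  rwa [integral_sub hsv hut, sub_eq_zero] at hzero

/-- `u` is the outgoing solution of `(Δ + κ²) u = s`, with far-field amplitude `F`, for an
integrable source `s`. -/
structure IsOutgoingSolution [FiniteDimensional ℝ E] [MeasurableSpace E] [BorelSpace E] (κ : ℝ)
    (u s F : E → ℂ) : Prop where
  farField : HasFarField κ u F
  integrable : Integrable s
  weak : IsWeakHelmholtz κ u s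

lemma exists_bump_tendsto_zero (G : Type*) [NormedAddCommGroup G] :
    ∃ ρ : ℕ → ContDiffBump (0 : G), Tendsto (fun n => (ρ n).rOut) atTop (𝓝 0) :=
  ⟨fun n => ⟨1 / ((n : ℝ) + 1) / 2, 1 / ((n : ℝ) + 1), by positivity,
    half_lt_self (by positivity)⟩, tendsto_one_div_add_atTop_nhds_zero_nat⟩

theorem IsOutgoingSolution.reciprocity {κ : ℝ} {u s F v t G : Space3 → ℂ}
    (hu : IsOutgoingSolution κ u s F) (hv : IsOutgoingSolution κ v t G) :
    ∫ x, s x * v x = ∫ x, u x * t x := by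
  obtain ⟨ρ, hρ⟩ := exists_bump_tendsto_zero Space3
  obtain ⟨Bu, hBu⟩ := hu.farField.exists_bound
  obtain ⟨Bv, hBv⟩ := hv.farField.exists_bound
  have hleft := tendsto_integral_conv_kernel_mul_conv_kernel hρ hu.integrable
    hv.farField.continuous hBv
  have hright := tendsto_integral_conv_kernel_mul_conv_kernel hρ hv.integrable
    hu.farField.continuous hBu
  simp only [mul_comm (u _)]
  refine tendsto_nhds_unique hleft (hright.congr fun n => ?_)
  have hmollified {f r H : Space3 → ℂ} (hf : IsOutgoingSolution κ f r H) :=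
    hf.weak.laplacian_conv_add hf.farField.continuous.locallyIntegrable (contDiff_kernel (ρ n))
      (hasCompactSupport_kernel _)
  have hsommerfeld {f r H : Space3 → ℂ} (hf : IsOutgoingSolution κ f r H) :=
    hf.farField.isSommerfeld_conv (contDiff_kernel (ρ n) (n := 2)) (hasCompactSupport_kernel _)
  have hsmooth := (hsommerfeld hu).reciprocity (hsommerfeld hv)
    (integrable_conv hu.integrable (integrable_kernel (ρ n)))
    (integrable_conv hv.integrable (integrable_kernel (ρ n))) (hmollified hu) (hmollified hv)
  rw [hsmooth]
  simp only [mul_comm]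

end Reciprocity

end OutgoingSolutions

/-! ### Smoothed spherical waves -/

section Radial

variable {E : Type*} [NormedAddCommGroup E] [InnerProductSpace ℝ E]

/-- The covector `⟪x, ·⟫`, with complex values. -/
noncomputable def innerCovector : E →L[ℝ] E →L[ℝ] ℂ :=
  ContinuousLinearMap.compL ℝ E ℝ ℂ Complex.ofRealCLM ∘L innerSL ℝ

lemma innerCovector_apply (x a : E) : innerCovector x a = (inner ℝ x a : ℝ) := rfl

lemma hasFDerivAt_comp_norm {q : ℝ → ℂ} {q₁ : ℂ} {x : E} (hx : x ≠ 0)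
    (hq : HasDerivAt q q₁ ‖x‖) :
    HasFDerivAt (fun y : E => q ‖y‖) ((q₁ / ‖x‖) • innerCovector x) x := by
  have hnorm : HasFDerivAt (fun y : E => ‖y‖) (fderiv ℝ (fun y : E => ‖y‖) x) x :=
    ((contDiffAt_norm ℝ hx (n := 1)).differentiableAt one_ne_zero).hasFDerivAt
  have hsq := (hnorm.pow 2).unique (hasStrictFDerivAt_norm_sq x).hasFDerivAt
  refine (hq.hasFDerivAt.comp x hnorm).congr_fderiv (ContinuousLinearMap.ext fun a => ?_)
  have ha : ‖x‖ * fderiv ℝ (fun y : E => ‖y‖) x a = inner ℝ x a := by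
    simpa [mul_assoc] using congrArg (fun L : E →L[ℝ] ℝ => L a) hsq
  have hx' : (‖x‖ : ℂ) ≠ 0 := by exact_mod_cast norm_ne_zero_iff.2 hx
  simp [innerCovector_apply, ← ha]
  field_simp

lemma laplacian_comp_norm [FiniteDimensional ℝ E] {q q₁ : ℝ → ℂ} {q₂ : ℂ} {x : E} (hx : x ≠ 0)
    (hq : ∀ r > 0, HasDerivAt q (q₁ r) r) (hq₁ : HasDerivAt q₁ q₂ ‖x‖) :
    (Δ fun y : E => q ‖y‖) x = q₂ + (Module.finrank ℝ E - 1) * q₁ ‖x‖ / ‖x‖ := by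
  have hx' : (‖x‖ : ℂ) ≠ 0 := by exact_mod_cast norm_ne_zero_iff.2 hx
  have hgradient : fderiv ℝ (fun y : E => q ‖y‖) =ᶠ[𝓝 x]
      fun y => (q₁ ‖y‖ / ‖y‖) • innerCovector y := by
    filter_upwards [isOpen_ne.mem_nhds hx] with y hy
    exact (hasFDerivAt_comp_norm hy (hq _ (norm_pos_iff.2 hy))).fderiv
  have hquot := hasFDerivAt_comp_norm hx (hq₁.div Complex.ofRealCLM.hasDerivAt hx')
  have hdivergence : divergence innerCovector x = Module.finrank ℝ E := by
    simp [divergence, innerCovector_apply]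
  have hdot : dot (innerCovector x) (innerCovector x) = (‖x‖ : ℂ) ^ 2 := by
    have hsum := (stdOrthonormalBasis ℝ E).sum_sq_inner_left x
    simp only [dot, innerCovector_apply, ← pow_two]
    exact_mod_cast hsum
  have hsmul := divergence_smul hquot.differentiableAt innerCovector.differentiableAt
  rw [laplacian_eq_divergence_fderiv, divergence, hgradient.fderiv_eq]
  refine hsmul.trans ?_
  have hdot_smul (c : ℂ) : dot (c • innerCovector x) (innerCovector x) = c * (‖x‖ : ℂ) ^ 2 := by
    rw [← hdot]
    simp [dot, Finset.mul_sum, mul_assoc]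
  rw [hquot.fderiv, hdivergence, hdot_smul]
  simp
  field_simp
  ring

lemma laplacian_div_norm {b b₁ : ℝ → ℂ} {b₂ : ℂ} {x : Space3} (hx : x ≠ 0)
    (hb : ∀ r, HasDerivAt b (b₁ r) r) (hb₁ : HasDerivAt b₁ b₂ ‖x‖) :
    (Δ fun y : Space3 => b ‖y‖ / ‖y‖) x = b₂ / ‖x‖ := by
  have hx' : (‖x‖ : ℂ) ≠ 0 := by exact_mod_cast norm_ne_zero_iff.2 hx
  have hid (r : ℝ) : HasDerivAt (fun r : ℝ => (r : ℂ)) 1 r := Complex.ofRealCLM.hasDerivAt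
  have hquot (r : ℝ) (hr : r > 0) :=
    (hb r).fun_div (hid r) (by exact_mod_cast hr.ne' : (r : ℂ) ≠ 0)
  have hquot₁ := ((hb₁.fun_mul (hid _)).fun_sub ((hb ‖x‖).fun_mul (hasDerivAt_const _ 1))).fun_div
    ((hid ‖x‖).fun_pow 2) (pow_ne_zero 2 hx')
  rw [laplacian_comp_norm hx hquot hquot₁, finrank_euclideanSpace_fin]
  push_cast
  field_simp
  ring

end Radial

section Step

/-- A smooth step from `0` on `(-∞, 1]` to `1` on `[2, ∞)`. -/
noncomputable def step (r : ℝ) : ℝ := Real.smoothTransition (r - 1)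

lemma contDiff_step {n : ℕ∞} : ContDiff ℝ n step :=
  Real.smoothTransition.contDiff.comp (contDiff_id.sub contDiff_const)

lemma step_eq_zero {r : ℝ} (h : r ≤ 1) : step r = 0 :=
  Real.smoothTransition.zero_of_nonpos (by linarith)

lemma step_eq_one {r : ℝ} (h : 2 ≤ r) : step r = 1 :=
  Real.smoothTransition.one_of_one_le (by linarith)

lemma norm_step_le (r : ℝ) : ‖step r‖ ≤ 1 := by
  rw [step, Real.norm_of_nonneg (Real.smoothTransition.nonneg _)]
  exact Real.smoothTransition.le_one _

lemma hasDerivAt_step (r : ℝ) : HasDerivAt step (deriv step r) r :=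
  ((contDiff_step (n := 1)).differentiable one_ne_zero r).hasDerivAt

lemma contDiff_deriv_step : ContDiff ℝ 1 (deriv step) :=
  (contDiff_succ_iff_deriv.1 (contDiff_step (n := 2))).2.2

lemma hasDerivAt_deriv_step (r : ℝ) : HasDerivAt (deriv step) (deriv (deriv step) r) r :=
  (contDiff_deriv_step.differentiable one_ne_zero r).hasDerivAt

lemma continuous_deriv_deriv_step : Continuous (deriv (deriv step)) :=
  contDiff_deriv_step.continuous_deriv le_rfl

lemma deriv_step_eq_zero {r : ℝ} (h : r ∉ Set.Icc 1 2) : deriv step r = 0 := by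
  have hlocal : ∃ c : ℝ, step =ᶠ[𝓝 r] fun _ => c := by
    rcases not_and_or.1 h with hr | hr <;> rw [not_le] at hr
    · exact ⟨0, by filter_upwards [Iio_mem_nhds hr] with y hy using step_eq_zero hy.le⟩
    · exact ⟨1, by filter_upwards [Ioi_mem_nhds hr] with y hy using step_eq_one hy.le⟩
  obtain ⟨c, hc⟩ := hlocal
  rw [hc.deriv_eq, deriv_const]

lemma deriv_deriv_step_eq_zero {r : ℝ} (h : r ∉ Set.Icc 1 2) : deriv (deriv step) r = 0 := by
  have hlocal : deriv step =ᶠ[𝓝 r] fun _ => 0 := by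
    filter_upwards [isClosed_Icc.isOpen_compl.mem_nhds h] with y hy using deriv_step_eq_zero hy
  rw [hlocal.deriv_eq, deriv_const]

lemma integral_mul_deriv_deriv_step : ∫ r in Set.Ioi (0 : ℝ), r * deriv (deriv step) r = -1 := by
  have hprimitive (r : ℝ) : HasDerivAt (fun r => r * deriv step r - step r)
      (r * deriv (deriv step) r) r :=
    (((hasDerivAt_id r).fun_mul (hasDerivAt_deriv_step r)).fun_sub
      (hasDerivAt_step r)).congr_deriv (by simp)
  have hsupport : HasCompactSupport (deriv (deriv step)) :=
    HasCompactSupport.intro isCompact_Icc fun _ => deriv_deriv_step_eq_zero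
  have hintegrable : Integrable fun r => r * deriv (deriv step) r :=
    (continuous_id.mul continuous_deriv_deriv_step).integrable_of_hasCompactSupport
      hsupport.mul_left
  have hlimit : Tendsto (fun r => r * deriv step r - step r) atTop (𝓝 (-1)) := by
    refine tendsto_const_nhds.congr' ?_
    filter_upwards [eventually_gt_atTop 2] with r hr
    rw [deriv_step_eq_zero fun h => hr.not_ge h.2, step_eq_one hr.le]
    simp
  rw [integral_Ioi_of_hasDerivAt_of_tendsto' (fun r _ => hprimitive r) hintegrable.integrableOn
    hlimit]
  simp [step_eq_zero]

lemma integral_comp_norm_space (f : ℝ → ℝ) :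
    ∫ z : Space3, f ‖z‖ = 4 * Real.pi * ∫ r in Set.Ioi (0 : ℝ), r ^ 2 * f r := by
  have hball : volume.real (Metric.ball (0 : Space3) 1) = Real.pi * 4 / 3 := by
    rw [measureReal_def, EuclideanSpace.volume_ball_fin_three, ENNReal.toReal_mul]
    simp [ENNReal.toReal_ofReal (show 0 ≤ Real.pi * 4 / 3 by positivity)]
  rw [integral_fun_norm_addHaar, hball, finrank_euclideanSpace_fin]
  simp only [smul_eq_mul, nsmul_eq_mul, Nat.add_one_sub_one]
  push_cast
  ring

lemma integral_deriv_deriv_step_div_norm :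
    ∫ z : Space3, deriv (deriv step) ‖z‖ / ‖z‖ = -(4 * Real.pi) := by
  rw [integral_comp_norm_space fun r => deriv (deriv step) r / r,
    setIntegral_congr_fun (g := fun r => r * deriv (deriv step) r) measurableSet_Ioi
      fun r (hr : 0 < r) => by field_simp, integral_mul_deriv_deriv_step]
  ring

end Step

section SphericalWave

/-- The outgoing spherical wave `e^{iκr}/r`, smoothly cut off at distances of order `δ` from the
origin. -/
noncomputable def sphericalWave (κ δ : ℝ) (x : Space3) : ℂ :=
  step (‖x‖ / δ) * phase (κ * ‖x‖) / ‖x‖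

/-- The source `(Δ + κ²) (sphericalWave κ δ)`, supported in the shell `δ ≤ r ≤ 2δ`. -/
noncomputable def sphericalSource (κ δ : ℝ) (x : Space3) : ℂ :=
  (deriv (deriv step) (‖x‖ / δ) / δ ^ 2 + 2 * Complex.I * κ * (deriv step (‖x‖ / δ) / δ)) *
    phase (κ * ‖x‖) / ‖x‖

lemma norm_sphericalWave_le (κ δ : ℝ) (x : Space3) : ‖sphericalWave κ δ x‖ ≤ ‖x‖⁻¹ := by
  rw [sphericalWave, norm_div, norm_mul, norm_phase, mul_one, Complex.norm_real, Complex.norm_real,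
    norm_norm, ← one_div]
  gcongr
  exact norm_step_le _

lemma sphericalWave_neg (κ δ : ℝ) (x : Space3) : sphericalWave κ δ (-x) = sphericalWave κ δ x := by
  simp only [sphericalWave, norm_neg]

lemma sphericalWave_eventuallyEq_zero (κ : ℝ) {δ : ℝ} (hδ : 0 < δ) {x : Space3} (hx : ‖x‖ < δ) :
    sphericalWave κ δ =ᶠ[𝓝 x] 0 := by
  filter_upwards [(isOpen_lt continuous_norm continuous_const).mem_nhds hx] with y (hy : ‖y‖ < δ)
  simp [sphericalWave, step_eq_zero ((div_le_one hδ).2 hy.le)]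

lemma sphericalSource_eq_zero (κ : ℝ) {δ : ℝ} {x : Space3} (hx : ‖x‖ / δ ∉ Set.Icc 1 2) :
    sphericalSource κ δ x = 0 := by
  simp [sphericalSource, deriv_step_eq_zero hx, deriv_deriv_step_eq_zero hx]

lemma contDiff_sphericalWave (κ : ℝ) {δ : ℝ} (hδ : 0 < δ) : ContDiff ℝ 2 (sphericalWave κ δ) := by
  refine contDiff_iff_contDiffAt.2 fun x => ?_
  rcases lt_or_ge ‖x‖ δ with hx | hx
  · exact contDiffAt_const.congr_of_eventuallyEq (sphericalWave_eventuallyEq_zero κ hδ hx)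
  have hx0 : x ≠ 0 := norm_pos_iff.1 (hδ.trans_le hx)
  have hnorm : ContDiffAt ℝ 2 (fun y : Space3 => ‖y‖) x := contDiffAt_norm ℝ hx0
  have hcast : ContDiff ℝ 2 (fun r : ℝ => (r : ℂ)) := Complex.ofRealCLM.contDiff
  have hstep : ContDiffAt ℝ 2 (fun y : Space3 => (step (‖y‖ / δ) : ℂ)) x :=
    (hcast.comp (contDiff_step (n := 2))).contDiffAt.comp x (hnorm.div_const δ)
  have hphase : ContDiffAt ℝ 2 (fun y : Space3 => phase (κ * ‖y‖)) x :=
    contDiff_phase.contDiffAt.comp x (contDiffAt_const.mul hnorm)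
  have hinv : ContDiffAt ℝ 2 (fun y : Space3 => (‖y‖ : ℂ)⁻¹) x :=
    (hcast.contDiffAt.comp x hnorm).inv (Complex.ofReal_ne_zero.2 (norm_ne_zero_iff.2 hx0))
  exact (hstep.mul hphase).mul hinv

lemma laplacian_sphericalWave_add (κ : ℝ) {δ : ℝ} (hδ : 0 < δ) (x : Space3) :
    (Δ (sphericalWave κ δ)) x + (κ : ℂ) ^ 2 * sphericalWave κ δ x = sphericalSource κ δ x := by
  rcases lt_or_ge ‖x‖ δ with hx | hx
  · have hzero := sphericalWave_eventuallyEq_zero κ hδ hx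
    rw [(InnerProductSpace.laplacian_congr_nhds hzero).eq_of_nhds, hzero.eq_of_nhds,
      sphericalSource_eq_zero κ fun h => h.1.not_gt ((div_lt_one hδ).2 hx)]
    simp [laplacian_eq_divergence_fderiv, divergence]
  have hx0 : x ≠ 0 := norm_pos_iff.1 (hδ.trans_le hx)
  have hscaled {f f₁ : ℝ → ℝ} (hf : ∀ r, HasDerivAt f (f₁ r) r) (r : ℝ) :
      HasDerivAt (fun r => (f (r / δ) : ℂ)) (f₁ (r / δ) / δ) r := by
    have h := ((hf (r / δ)).comp r ((hasDerivAt_id r).div_const δ)).ofReal_comp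
    exact h.congr_deriv (by simp [div_eq_mul_inv])
  have hstep := hscaled hasDerivAt_step
  have hstep₁ (r : ℝ) := (hscaled hasDerivAt_deriv_step r).div_const (δ : ℂ)
  have hphase (r : ℝ) : HasDerivAt (fun r => phase (κ * r)) (Complex.I * κ * phase (κ * r)) r :=
    ((hasDerivAt_phase (κ * r)).scomp r ((hasDerivAt_id r).const_mul κ)).congr_deriv
      (by simp; ring)
  have hprofile (r : ℝ) := (hstep r).fun_mul (hphase r)
  have hprofile₁ := ((hstep₁ ‖x‖).fun_mul (hphase _)).fun_add
    ((hstep _).fun_mul ((hphase _).const_mul (Complex.I * κ)))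
  have hlaplacian := laplacian_div_norm hx0 hprofile hprofile₁
  have hwave : sphericalWave κ δ = fun y => step (‖y‖ / δ) * phase (κ * ‖y‖) / ‖y‖ := rfl
  rw [hwave, hlaplacian, sphericalSource]
  ring_nf
  rw [Complex.I_sq]
  ring

lemma continuous_sphericalSource (κ : ℝ) {δ : ℝ} (hδ : 0 < δ) :
    Continuous (sphericalSource κ δ) := by
  have hwave := contDiff_sphericalWave κ hδ
  exact ((continuous_laplacian hwave).add (continuous_const.mul hwave.continuous)).congr
    (laplacian_sphericalWave_add κ hδ)

lemma hasCompactSupport_sphericalSource (κ : ℝ) {δ : ℝ} (hδ : 0 < δ) :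
    HasCompactSupport (sphericalSource κ δ) := by
  refine HasCompactSupport.intro (isCompact_closedBall (0 : Space3) (2 * δ)) fun x hx => ?_
  rw [mem_closedBall_zero_iff] at hx
  exact sphericalSource_eq_zero κ fun h => hx ((div_le_iff₀ hδ).1 h.2)

lemma isOutgoingSolution_sphericalWave (κ : ℝ) {δ : ℝ} (hδ : 0 < δ) :
    IsOutgoingSolution κ (sphericalWave κ δ) (sphericalSource κ δ) fun _ => 1 where
  farField :=
    { continuous := (contDiff_sphericalWave κ hδ).continuous
      continuousOn := continuousOn_const
      asymptotics := by
        refine tendsto_const_nhds.congr' ?_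
        filter_upwards [eventually_ne_cobounded 0,
          tendsto_norm_cobounded_atTop.eventually_ge_atTop (2 * δ)] with x hx0 hx
        have hx' : (‖x‖ : ℂ) ≠ 0 := by exact_mod_cast norm_ne_zero_iff.2 hx0
        rw [sphericalWave, step_eq_one ((le_div_iff₀ hδ).2 hx)]
        push_cast
        field_simp
        ring }
  integrable := (continuous_sphericalSource κ hδ).integrable_of_hasCompactSupport
    (hasCompactSupport_sphericalSource κ hδ)
  weak := .of_laplacian (contDiff_sphericalWave κ hδ) (laplacian_sphericalWave_add κ hδ)

end SphericalWave

section Transform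

variable {E : Type*} [NormedAddCommGroup E] [InnerProductSpace ℝ E] [MeasureSpace E]

/-- The Fourier integral `∫ s(x) e^{iκ⟨m, x⟩} dx`. -/
noncomputable def transform (κ : ℝ) (s : E → ℂ) (m : E) : ℂ :=
  ∫ x, s x * phase (κ * inner ℝ m x)

lemma continuous_transform [BorelSpace E] [SecondCountableTopology E] (κ : ℝ) {s : E → ℂ}
    (hs : Integrable s) : Continuous (transform κ s) := by
  refine continuous_of_dominated (bound := fun x => ‖s x‖) (fun m => ?_) (fun m => ?_) hs.norm ?_
  · exact hs.aestronglyMeasurable.mul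
      (contDiff_phase_inner κ m (m := 0)).continuous.aestronglyMeasurable
  · exact ae_of_all _ fun x => by rw [norm_mul, norm_phase, mul_one]
  · exact ae_of_all _ fun x => by fun_prop

lemma integrable_comp_norm_div_norm {φ : ℝ → ℝ} (hφ : Continuous φ) (hc : HasCompactSupport φ) :
    Integrable fun z : Space3 => φ ‖z‖ / ‖z‖ := by
  rw [integrable_fun_norm_addHaar volume (f := fun r => φ r / r), finrank_euclideanSpace_fin]
  have hradial : Integrable fun r => r * φ r :=
    (continuous_id.mul hφ).integrable_of_hasCompactSupport hc.mul_left
  refine hradial.integrableOn.congr_fun (fun r (hr : 0 < r) => ?_) measurableSet_Ioi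
  simp
  field_simp

lemma exists_integrable_bound_sphericalSource : ∃ g : Space3 → ℝ, Integrable g ∧
    ∀ κ, |κ| ≤ 1 → ∀ z, ‖sphericalSource κ 1 z‖ ≤ g z := by
  have hshell {φ : ℝ → ℝ} (hφ : Continuous φ) (hzero : ∀ r ∉ Set.Icc 1 2, φ r = 0) :
      Integrable fun z : Space3 => ‖φ ‖z‖ / ‖z‖‖ :=
    (integrable_comp_norm_div_norm hφ (.intro isCompact_Icc hzero)).norm
  refine ⟨_, (hshell continuous_deriv_deriv_step fun _ => deriv_deriv_step_eq_zero).add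
    ((hshell contDiff_deriv_step.continuous fun _ => deriv_step_eq_zero).const_mul 2),
    fun κ hκ z => ?_⟩
  have hnum : ‖(deriv (deriv step) ‖z‖ + 2 * Complex.I * κ * deriv step ‖z‖ : ℂ)‖ ≤
      ‖deriv (deriv step) ‖z‖‖ + 2 * ‖deriv step ‖z‖‖ := by
    refine (norm_add_le _ _).trans ?_
    simp only [norm_mul, Complex.norm_real, Complex.norm_I, Complex.norm_ofNat, mul_one]
    gcongr
    nlinarith [norm_nonneg (deriv step ‖z‖), Real.norm_eq_abs κ]
  simp only [sphericalSource, div_one, one_pow, Complex.ofReal_one, norm_div, norm_mul, norm_phase,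
    mul_one, Complex.norm_real, norm_norm, Pi.add_apply]
  rw [mul_div_assoc', ← add_div]
  gcongr

lemma sphericalSource_smul (κ : ℝ) {δ : ℝ} (hδ : 0 < δ) (z : Space3) :
    sphericalSource κ δ (δ • z) = ((δ ^ 3)⁻¹ : ℝ) * sphericalSource (κ * δ) 1 z := by
  have hδ' : (δ : ℂ) ≠ 0 := by exact_mod_cast hδ.ne'
  simp only [sphericalSource, norm_smul, Real.norm_of_nonneg hδ.le, mul_div_cancel_left₀ _ hδ.ne',
    div_one, ← mul_assoc]
  push_cast
  field_simp

lemma transform_sphericalSource (κ : ℝ) {δ : ℝ} (hδ : 0 < δ) (m : Space3) :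
    transform κ (sphericalSource κ δ) m = transform (κ * δ) (sphericalSource (κ * δ) 1) m := by
  have hscale := Measure.integral_comp_smul_of_nonneg (volume : Measure Space3)
    (fun x => sphericalSource κ δ x * phase (κ * inner ℝ m x)) δ (hR := hδ.le)
  simp only [sphericalSource_smul κ hδ, finrank_euclideanSpace_fin, real_inner_smul_right,
    mul_assoc ((_ : ℝ) : ℂ), integral_const_mul, Complex.real_smul, ← mul_assoc κ] at hscale
  exact (mul_left_cancel₀ (by simpa using hδ.ne') hscale).symm

lemma tendsto_transform_sphericalSource (κ : ℝ) (m : Space3) :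
    Tendsto (fun δ => transform κ (sphericalSource κ δ) m) (𝓝[>] 0) (𝓝 (-(4 * Real.pi) : ℝ)) := by
  have hrescaled : Tendsto (fun c => transform c (sphericalSource c 1) m) (𝓝 0)
      (𝓝 (-(4 * Real.pi) : ℝ)) := by
    obtain ⟨g, hg, hbound⟩ := exists_integrable_bound_sphericalSource
    rw [← integral_deriv_deriv_step_div_norm, ← integral_complex_ofReal]
    refine tendsto_integral_filter_of_dominated_convergence g (.of_forall fun c => ?_) ?_ hg
      (ae_of_all _ fun z => ?_)
    · exact ((continuous_sphericalSource c one_pos).mul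
        (contDiff_phase_inner c m (m := 0)).continuous).aestronglyMeasurable
    · filter_upwards [Metric.closedBall_mem_nhds (0 : ℝ) one_pos] with c hc
      refine ae_of_all _ fun z => ?_
      rw [norm_mul, norm_phase, mul_one]
      exact hbound c (by simpa using hc) z
    · have hcontinuous : Continuous fun c => sphericalSource c 1 z * phase (c * inner ℝ m z) := by
        unfold sphericalSource
        fun_prop
      convert! hcontinuous.tendsto 0 using 2
      simp [sphericalSource, phase_zero]
  have hzero : Tendsto (fun δ => κ * δ) (𝓝[>] 0) (𝓝 0) :=
    ((continuous_const_mul κ).tendsto' 0 0 (mul_zero κ)).mono_left nhdsWithin_le_nhds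
  refine (hrescaled.comp hzero).congr' ?_
  filter_upwards [self_mem_nhdsWithin] with δ hδ using (transform_sphericalSource κ hδ m).symm

end Transform

/-! ### The amplitude of an outgoing solution -/

section Pairing

variable {κ : ℝ} {u s F : Space3 → ℂ}

lemma IsOutgoingSolution.comp_add (h : IsOutgoingSolution κ u s F) (y : Space3) :
    IsOutgoingSolution κ (fun x => u (x + y)) (fun x => s (x + y))
      (fun n => F n * phase (κ * inner ℝ n y)) where
  farField := h.farField.comp_add y
  integrable := h.integrable.comp_add_right y
  weak := h.weak.comp_add y

lemma IsOutgoingSolution.integral_mul_sphericalWave (h : IsOutgoingSolution κ u s F) {δ : ℝ}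
    (hδ : 0 < δ) (z : Space3) :
    ∫ x, s x * sphericalWave κ δ (z - x) = ∫ y, u (z + y) * sphericalSource κ δ y := by
  have hreciprocity := h.reciprocity ((isOutgoingSolution_sphericalWave κ hδ).comp_add (-z))
  simp only [← sub_eq_add_neg] at hreciprocity
  simp only [← neg_sub _ z, sphericalWave_neg, hreciprocity]
  rw [← integral_add_left_eq_self _ z]
  simp only [add_sub_cancel_left]

end Pairing

section Newtonian

variable {E : Type*} [NormedAddCommGroup E] [InnerProductSpace ℝ E] [FiniteDimensional ℝ E]
  [MeasurableSpace E] [BorelSpace E]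

lemma integrableOn_inv_norm_ball (hE : 1 < Module.finrank ℝ E) :
    IntegrableOn (fun y : E => ‖y‖⁻¹) (Metric.ball 0 1) := by
  have : Nontrivial E := Module.nontrivial_of_finrank_pos (R := ℝ) (by omega)
  obtain ⟨d, hd⟩ : ∃ d, Module.finrank ℝ E - 1 = d + 1 := ⟨Module.finrank ℝ E - 2, by omega⟩
  rw [integrableOn_fun_norm_addHaar volume (f := fun r : ℝ => r⁻¹), hd]
  have hpow : IntegrableOn (fun r : ℝ => r ^ d) (Set.Ioo 0 1) :=
    ((continuous_pow d).integrableOn_Icc (a := 0) (b := 1)).mono_set Set.Ioo_subset_Icc_self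
  refine hpow.congr_fun (fun r hr => ?_) measurableSet_Ioo
  simp [pow_succ, hr.1.ne']

lemma exists_lintegral_inv_dist_le (hE : 1 < Module.finrank ℝ E) {B : Set E} (hB : volume B < ⊤) :
    ∃ C < ⊤, ∀ z : E, ∫⁻ y in B, ‖‖z - y‖⁻¹‖ₑ ≤ C := by
  let near : E → ℝ≥0∞ := (Metric.ball 0 1).indicator fun y => ‖‖y‖⁻¹‖ₑ
  have hnear : ∫⁻ y, near y < ⊤ := by
    rw [lintegral_indicator measurableSet_ball]
    exact (integrableOn_inv_norm_ball hE).2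
  refine ⟨(∫⁻ y, near y) + volume B, ENNReal.add_lt_top.2 ⟨hnear, hB⟩, fun z => ?_⟩
  have hsplit (y : E) : ‖‖y‖⁻¹‖ₑ ≤ near y + 1 := by
    by_cases hy : y ∈ Metric.ball 0 1
    · rw [show near y = ‖‖y‖⁻¹‖ₑ from Set.indicator_of_mem hy _]
      exact le_self_add
    · have hle : ‖y‖⁻¹ ≤ 1 := inv_le_one_of_one_le₀ (by simpa using hy)
      refine le_add_left ?_
      rw [← enorm_one (G := ℝ), enorm_le_iff_norm_le]
      simpa using hle
  calc ∫⁻ y in B, ‖‖z - y‖⁻¹‖ₑ ≤ ∫⁻ y in B, (near (z - y) + 1) := lintegral_mono fun _ => hsplit _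
    _ = (∫⁻ y in B, near (z - y)) + volume B := by
        rw [lintegral_add_right _ measurable_const]
        simp
    _ ≤ (∫⁻ y, near (z - y)) + volume B := by
        gcongr
        exact Measure.restrict_le_self
    _ = _ := by rw [lintegral_sub_left_eq_self]

end Newtonian

section Kernel

variable {X Y : Type*} [MeasurableSpace X] [MeasurableSpace Y] {μ : Measure X} {ν : Measure Y}
  [SFinite μ] [SFinite ν] {s : X → ℂ}

lemma lintegral_enorm_integral_mul_le (hs : AEStronglyMeasurable s μ) {K : X → Y → ℂ}
    (hK : Measurable fun p : X × Y => K p.1 p.2) :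
    ∫⁻ y, ‖∫ x, s x * K x y ∂μ‖ₑ ∂ν ≤ ∫⁻ x, ‖s x‖ₑ * ∫⁻ y, ‖K x y‖ₑ ∂ν ∂μ :=
  calc _ ≤ ∫⁻ y, ∫⁻ x, ‖s x‖ₑ * ‖K x y‖ₑ ∂μ ∂ν := by
        refine lintegral_mono fun y => (enorm_integral_le_lintegral_enorm _).trans_eq ?_
        simp only [enorm_mul]
    _ = ∫⁻ x, ∫⁻ y, ‖s x‖ₑ * ‖K x y‖ₑ ∂ν ∂μ :=
        lintegral_lintegral_swap <| AEMeasurable.mul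
          (hs.enorm.comp_quasiMeasurePreserving Measure.quasiMeasurePreserving_snd)
          (hK.enorm.comp measurable_swap).aemeasurable
    _ = _ := lintegral_congr fun _ =>
        lintegral_const_mul _ (hK.enorm.comp measurable_prodMk_left)

lemma tendsto_lintegral_enorm_integral_mul {ι : Type*} {l : Filter ι} [l.IsCountablyGenerated]
    (hs : Integrable s μ) {K : ι → X → Y → ℂ} (hK : ∀ i, Measurable fun p : X × Y => K i p.1 p.2)
    {C : ℝ≥0∞} (hC : C ≠ ⊤) (hbound : ∀ᶠ i in l, ∀ x, ∫⁻ y, ‖K i x y‖ₑ ∂ν ≤ C)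
    (htendsto : ∀ x, Tendsto (fun i => ∫⁻ y, ‖K i x y‖ₑ ∂ν) l (𝓝 0)) :
    Tendsto (fun i => ∫⁻ y, ‖∫ x, s x * K i x y ∂μ‖ₑ ∂ν) l (𝓝 0) := by
  refine tendsto_of_tendsto_of_tendsto_of_le_of_le tendsto_const_nhds ?_ (fun _ => zero_le)
    fun i => lintegral_enorm_integral_mul_le hs.aestronglyMeasurable (hK i)
  rw [← lintegral_zero (μ := μ)]
  refine tendsto_lintegral_filter_of_dominated_convergence' (fun x => ‖s x‖ₑ * C)
    (.of_forall fun i => hs.aestronglyMeasurable.enorm.mul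
      (hK i).enorm.lintegral_prod_right'.aemeasurable) ?_ ?_ (ae_of_all _ fun x => ?_)
  · filter_upwards [hbound] with i hi
    exact ae_of_all _ fun x => by gcongr; exact hi x
  · rw [lintegral_mul_const' _ _ hC]
    exact (ENNReal.mul_lt_top hs.2 hC.lt_top).ne
  · simpa using ENNReal.Tendsto.const_mul (htendsto x) (Or.inr (enorm_ne_top (x := s x)))

end Kernel

section WaveDefect

/-- The error made at the point `z` when the regularized spherical wave centred at `x` is
replaced, up to the factor `e^{iκ|z|}/|z|`, by the plane wave `e^{-iκ⟨z/|z|, x⟩}`. -/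
noncomputable def waveDefect (κ δ : ℝ) (x z : Space3) : ℂ :=
  ‖z‖ * sphericalWave κ δ (z - x) - phase (κ * ‖z‖) * phase (κ * inner ℝ (-normalize z) x)

lemma measurable_waveDefect (κ : ℝ) {δ : ℝ} (hδ : 0 < δ) :
    Measurable (Function.uncurry (waveDefect κ δ)) := by
  have hwave : Measurable (sphericalWave κ δ) := (contDiff_sphericalWave κ hδ).continuous.measurable
  have hphase : Measurable phase := continuous_phase.measurable
  unfold Function.uncurry waveDefect NormedSpace.normalize
  fun_prop

lemma tendsto_waveDefect (κ : ℝ) {δ : ℝ} (hδ : 0 < δ) (x : Space3) :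
    Tendsto (waveDefect κ δ x) (cobounded Space3) (𝓝 0) := by
  refine ((isOutgoingSolution_sphericalWave κ hδ).farField.comp_add (-x)).asymptotics.congr
    fun z => ?_
  simp [waveDefect, sub_eq_add_neg]

lemma norm_waveDefect_smul_le (κ δ : ℝ) {R : ℝ} (hR : 0 < R) (x y : Space3) :
    ‖waveDefect κ δ x (R • y)‖ ≤ ‖y‖ * ‖R⁻¹ • x - y‖⁻¹ + 1 := by
  have hdist : ‖R • y - x‖ = R * ‖R⁻¹ • x - y‖ := by
    rw [norm_sub_rev, ← Real.norm_of_nonneg hR.le, ← norm_smul, Real.norm_of_nonneg hR.le,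
      smul_sub, smul_inv_smul₀ hR.ne']
  calc ‖waveDefect κ δ x (R • y)‖ ≤ ‖R • y‖ * ‖sphericalWave κ δ (R • y - x)‖ + 1 := by
        refine (norm_sub_le _ _).trans_eq ?_
        simp only [norm_mul, norm_phase, mul_one, Complex.norm_real, norm_norm]
    _ ≤ ‖R • y‖ * ‖R • y - x‖⁻¹ + 1 := by
        gcongr
        exact norm_sphericalWave_le _ _ _
    _ = ‖y‖ * ‖R⁻¹ • x - y‖⁻¹ + 1 := by
        rw [hdist, norm_smul, Real.norm_of_nonneg hR.le, mul_inv]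
        field_simp

/-- The open shell `1 < ‖y‖ < 2`. -/
def annulus (E : Type*) [Norm E] : Set E := {y | 1 < ‖y‖ ∧ ‖y‖ < 2}

lemma isOpen_annulus (E : Type*) [SeminormedAddGroup E] : IsOpen (annulus E) :=
  (isOpen_lt continuous_const continuous_norm).inter (isOpen_lt continuous_norm continuous_const)

lemma ne_zero_of_mem_annulus {E : Type*} [SeminormedAddGroup E] {y : E} (hy : y ∈ annulus E) :
    y ≠ 0 := by
  rintro rfl
  simpa using hy.1.trans_le' zero_le_one

lemma isBounded_annulus (E : Type*) [SeminormedAddGroup E] : IsBounded (annulus E) :=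
  (Metric.isBounded_ball (x := (0 : E)) (r := 2)).subset fun y hy => by simpa using hy.2

lemma exists_lintegral_waveDefect_le (κ δ : ℝ) : ∃ C < ⊤, ∀ R : ℝ, 0 < R → ∀ x : Space3,
    ∫⁻ y in annulus Space3, ‖waveDefect κ δ x (R • y)‖ₑ ≤ C := by
  obtain ⟨C, hC, hbound⟩ := exists_lintegral_inv_dist_le (E := Space3) (by simp)
    (isBounded_annulus Space3).measure_lt_top
  refine ⟨2 * C + volume (annulus Space3), ENNReal.add_lt_top.2
    ⟨ENNReal.mul_lt_top (by simp) hC, (isBounded_annulus Space3).measure_lt_top⟩, fun R hR x => ?_⟩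
  have hpoint : ∀ y ∈ annulus Space3,
      ‖waveDefect κ δ x (R • y)‖ₑ ≤ 2 * ‖‖R⁻¹ • x - y‖⁻¹‖ₑ + 1 := fun y hy => by
    have hle : ‖waveDefect κ δ x (R • y)‖ ≤ 2 * ‖R⁻¹ • x - y‖⁻¹ + 1 :=
      (norm_waveDefect_smul_le κ δ hR x y).trans (by gcongr; exact hy.2.le)
    rw [← ofReal_norm]
    refine (ENNReal.ofReal_le_ofReal hle).trans_eq ?_
    rw [ENNReal.ofReal_add (by positivity) zero_le_one, ENNReal.ofReal_mul zero_le_two,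
      ← Real.enorm_of_nonneg (inv_nonneg.2 (norm_nonneg _))]
    simp
  refine (setLIntegral_mono (by fun_prop) hpoint).trans ?_
  rw [lintegral_add_right _ measurable_const, lintegral_const_mul _ (by fun_prop)]
  gcongr
  · exact hbound _
  · simp

lemma tendsto_lintegral_waveDefect (κ : ℝ) {δ : ℝ} (hδ : 0 < δ) (x : Space3) :
    Tendsto (fun R : ℝ => ∫⁻ y in annulus Space3, ‖waveDefect κ δ x (R • y)‖ₑ) atTop (𝓝 0) := by
  have hmeasurable (R : ℝ) : Measurable fun y => ‖waveDefect κ δ x (R • y)‖ₑ :=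
    ((measurable_waveDefect κ hδ).comp (by fun_prop : Measurable fun y => (x, R • y))).enorm
  have hannulus : MeasurableSet (annulus Space3) := (isOpen_annulus Space3).measurableSet
  rw [← lintegral_zero (μ := volume.restrict (annulus Space3))]
  refine tendsto_lintegral_filter_of_dominated_convergence (fun _ => 5)
    (.of_forall hmeasurable) ?_ ?_ ?_
  · filter_upwards [eventually_ge_atTop (2 * ‖x‖), eventually_gt_atTop 0] with R hR hR0
    filter_upwards [ae_restrict_mem hannulus] with y hy
    have hfar : 1 / 2 ≤ ‖R⁻¹ • x - y‖ := by
      have hx : ‖R⁻¹ • x‖ ≤ 1 / 2 := by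
        rw [norm_smul, norm_inv, Real.norm_of_nonneg hR0.le, inv_mul_le_iff₀ hR0]
        linarith
      have := norm_sub_norm_le y (R⁻¹ • x)
      rw [norm_sub_rev] at this
      linarith [hy.1]
    have hle : ‖waveDefect κ δ x (R • y)‖ ≤ 5 :=
      calc _ ≤ ‖y‖ * ‖R⁻¹ • x - y‖⁻¹ + 1 := norm_waveDefect_smul_le κ δ hR0 x y
        _ ≤ 2 * (1 / 2)⁻¹ + 1 := by gcongr; exact hy.2.le
        _ = 5 := by norm_num
    simpa [← ofReal_norm] using ENNReal.ofReal_le_ofReal hle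
  · simp [(isBounded_annulus Space3).measure_lt_top.ne, ENNReal.mul_eq_top]
  · filter_upwards [ae_restrict_mem hannulus] with y hy
    have hfar : Tendsto (fun R : ℝ => R • y) atTop (cobounded Space3) := by
      rw [← tendsto_norm_atTop_iff_cobounded]
      simp only [norm_smul]
      exact tendsto_norm_atTop_atTop.atTop_mul_const (by linarith [hy.1])
    simpa using ((tendsto_waveDefect κ hδ x).comp hfar).enorm

lemma tendsto_lintegral_integral_mul_waveDefect (κ : ℝ) {δ : ℝ} (hδ : 0 < δ) {s : Space3 → ℂ}
    (hs : Integrable s) :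
    Tendsto (fun R : ℝ => ∫⁻ y in annulus Space3, ‖∫ x, s x * waveDefect κ δ x (R • y)‖ₑ)
      atTop (𝓝 0) := by
  obtain ⟨C, hC, hbound⟩ := exists_lintegral_waveDefect_le κ δ
  refine tendsto_lintegral_enorm_integral_mul (K := fun R x y => waveDefect κ δ x (R • y)) hs
    (fun R => ?_) hC.ne ((eventually_gt_atTop 0).mono hbound) (tendsto_lintegral_waveDefect κ hδ)
  have hscaled := (measurable_waveDefect κ hδ).comp
    (measurable_fst.prodMk (measurable_snd.const_smul R))
  exact hscaled

end WaveDefect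

section Annulus

variable {E : Type*} [NormedAddCommGroup E] [InnerProductSpace ℝ E] [MeasureSpace E] [BorelSpace E]
  {κ : ℝ} {I G : E → ℂ}

lemma eventually_lintegral_annulus_enorm_comp_normalize_le
    (hI : Tendsto (fun z => I z - phase (κ * ‖z‖) * G (normalize z)) (cobounded E) (𝓝 0))
    {ε : NNReal} (hε : 0 < ε) :
    ∀ᶠ R : ℝ in atTop, ∫⁻ y in annulus E, ‖G (normalize y)‖ₑ ≤
      (∫⁻ y in annulus E, ‖I (R • y)‖ₑ) + ε * volume (annulus E) := by
  have hclose := hI.eventually (Metric.closedBall_mem_nhds 0 (NNReal.coe_pos.2 hε))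
  obtain ⟨R₀, -, hR₀⟩ := (hasBasis_cobounded_norm.eventually_iff).1 hclose
  filter_upwards [eventually_ge_atTop R₀, eventually_gt_atTop 0] with R hR hRpos
  have hpoint : ∀ y ∈ annulus E, ‖G (normalize y)‖ₑ ≤ ‖I (R • y)‖ₑ + ε := fun y hy => by
    have hnorm : R₀ ≤ ‖R • y‖ := by
      rw [norm_smul, Real.norm_of_nonneg hRpos.le]
      nlinarith [hy.1]
    have hdist := hR₀ hnorm
    rw [dist_zero_right, normalize_smul_of_pos hRpos] at hdist
    have hnn : ‖G (normalize y)‖ ≤ ‖I (R • y)‖ + ε := by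
      rw [← one_mul ‖G _‖, ← norm_phase (κ * ‖R • y‖), ← norm_mul]
      linarith [norm_sub_norm_le (phase (κ * ‖R • y‖) * G (normalize y)) (I (R • y)),
        norm_sub_rev (I (R • y)) (phase (κ * ‖R • y‖) * G (normalize y))]
    exact ENNReal.coe_le_coe.2 (show ‖G (normalize y)‖₊ ≤ ‖I (R • y)‖₊ + ε from hnn)
  rw [← setLIntegral_const, ← lintegral_add_right _ measurable_const]
  exact setLIntegral_mono' (isOpen_annulus E).measurableSet hpoint

lemma eq_zero_of_tendsto_lintegral_annulus [FiniteDimensional ℝ E]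
    [(volume : Measure E).IsOpenPosMeasure] [IsFiniteMeasureOnCompacts (volume : Measure E)]
    (hI : Tendsto (fun z => I z - phase (κ * ‖z‖) * G (normalize z)) (cobounded E) (𝓝 0))
    (hG : ContinuousOn G (Metric.sphere 0 1))
    (hzero : Tendsto (fun R : ℝ => ∫⁻ y in annulus E, ‖I (R • y)‖ₑ) atTop (𝓝 0))
    {n : E} (hn : n ∈ Metric.sphere (0 : E) 1) : G n = 0 := by
  have hcont : ContinuousOn (fun y => G (normalize y)) (annulus E) :=
    hG.comp (.smul (continuous_norm.continuousOn.inv₀ fun y hy =>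
      norm_ne_zero_iff.2 (ne_zero_of_mem_annulus hy)) continuousOn_id)
      fun y hy => normalize_mem_sphere (ne_zero_of_mem_annulus hy)
  have hle (ε : NNReal) (hε : 0 < ε) :
      ∫⁻ y in annulus E, ‖G (normalize y)‖ₑ ≤ ε * volume (annulus E) := by
    refine ge_of_tendsto ?_ (eventually_lintegral_annulus_enorm_comp_normalize_le hI hε)
    simpa using hzero.add_const (ε * volume (annulus E))
  have hintegral : ∫⁻ y in annulus E, ‖G (normalize y)‖ₑ = 0 := by
    have hlimit : Tendsto (fun ε : NNReal => ε * volume (annulus E)) (𝓝[>] 0) (𝓝 0) := by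
      have hcoe : Tendsto (fun ε : NNReal => (ε : ℝ≥0∞)) (𝓝[>] 0) (𝓝 0) :=
        ENNReal.tendsto_coe.2 (tendsto_id.mono_left nhdsWithin_le_nhds)
      simpa using ENNReal.Tendsto.mul_const hcoe (Or.inr (isBounded_annulus E).measure_lt_top.ne)
    refine le_zero_iff.1 (ge_of_tendsto hlimit ?_)
    filter_upwards [self_mem_nhdsWithin] using hle
  have hae := (lintegral_eq_zero_iff' (hcont.aestronglyMeasurable
    (isOpen_annulus E).measurableSet).enorm).1 hintegral
  have heqOn : Set.EqOn (fun y => G (normalize y)) 0 (annulus E) :=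
    Measure.eqOn_open_of_ae_eq (hae.mono fun y hy => by simpa using hy) (isOpen_annulus E) hcont
      continuousOn_const
  have hnorm : ‖n‖ = 1 := by simpa using hn
  have hmem : (3 / 2 : ℝ) • n ∈ annulus E := by
    constructor <;> rw [norm_smul, hnorm] <;> norm_num
  simpa [normalize_smul_of_pos, normalize_eq_self_of_norm_eq_one hnorm] using heqOn hmem

end Annulus

namespace IsOutgoingSolution

variable {κ δ : ℝ} {u s F : Space3 → ℂ}

lemma integral_mul_waveDefect (h : IsOutgoingSolution κ u s F) (hδ : 0 < δ) (z : Space3) :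
    ∫ x, s x * waveDefect κ δ x z = ‖z‖ * (∫ y, u (z + y) * sphericalSource κ δ y) -
      phase (κ * ‖z‖) * transform κ s (-normalize z) := by
  have hW := (isOutgoingSolution_sphericalWave κ hδ).farField
  obtain ⟨D, hD⟩ := hW.exists_bound
  have hwave : Integrable fun x => s x * sphericalWave κ δ (z - x) :=
    h.integrable.mul_bdd (hW.continuous.comp (by fun_prop)).aestronglyMeasurable
      (ae_of_all _ fun x => hD (z - x))
  have hphase : Integrable fun x => s x * phase (κ * inner ℝ (-normalize z) x) :=
    h.integrable.mul_bdd (c := 1) (by fun_prop : Continuous _).aestronglyMeasurable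
      (ae_of_all _ fun x => (norm_phase _).le)
  calc ∫ x, s x * waveDefect κ δ x z
      = ∫ x, (‖z‖ * (s x * sphericalWave κ δ (z - x)) -
          phase (κ * ‖z‖) * (s x * phase (κ * inner ℝ (-normalize z) x))) := by
        congr with x
        rw [waveDefect]
        ring
    _ = _ := by
        rw [integral_sub (hwave.const_mul _) (hphase.const_mul _), integral_const_mul,
          integral_const_mul, h.integral_mul_sphericalWave hδ, transform]

lemma tendsto_integral_mul_waveDefect (h : IsOutgoingSolution κ u s F) (hδ : 0 < δ) :
    Tendsto (fun z => (∫ x, s x * waveDefect κ δ x z) - phase (κ * ‖z‖) *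
        (F (normalize z) * transform κ (sphericalSource κ δ) (normalize z) -
          transform κ s (-normalize z)))
      (cobounded Space3) (𝓝 0) := by
  refine (h.farField.average (continuous_sphericalSource κ hδ)
    (hasCompactSupport_sphericalSource κ hδ)).congr fun z => ?_
  rw [h.integral_mul_waveDefect hδ]
  simp only [transform, mul_comm (phase (κ * inner ℝ _ _))]
  ring

lemma amplitude_mul_transform (h : IsOutgoingSolution κ u s F) (hδ : 0 < δ) {n : Space3}
    (hn : n ∈ Metric.sphere (0 : Space3) 1) :
    F n * transform κ (sphericalSource κ δ) n = transform κ s (-n) := by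
  have hS := (isOutgoingSolution_sphericalWave κ hδ).integrable
  have hG : ContinuousOn
      (fun n => F n * transform κ (sphericalSource κ δ) n - transform κ s (-n))
      (Metric.sphere 0 1) :=
    (h.farField.continuousOn.mul (continuous_transform κ hS).continuousOn).sub
      ((continuous_transform κ h.integrable).comp continuous_neg).continuousOn
  rw [← sub_eq_zero]
  refine eq_zero_of_tendsto_lintegral_annulus (κ := κ)
    (I := fun z => ∫ x, s x * waveDefect κ δ x z) ?_ hG ?_ hn
  · exact h.tendsto_integral_mul_waveDefect hδ
  · exact tendsto_lintegral_integral_mul_waveDefect κ hδ h.integrable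

lemma amplitude_eq (h : IsOutgoingSolution κ u s F) {n : Space3}
    (hn : n ∈ Metric.sphere (0 : Space3) 1) :
    (-(4 * Real.pi) : ℝ) * F n = transform κ s (-n) := by
  rw [mul_comm]
  refine tendsto_nhds_unique ((tendsto_transform_sphericalSource κ n).const_mul (F n))
    (tendsto_const_nhds.congr' ?_)
  filter_upwards [self_mem_nhdsWithin] with δ hδ using (h.amplitude_mul_transform hδ hn).symm

end IsOutgoingSolution

/-! ### Scattering states -/

section SphereAmplitude

/-- A function on the unit sphere, extended by zero. -/
noncomputable def extendSphere {E : Type*} [NormedAddCommGroup E]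
    (f : Metric.sphere (0 : E) 1 → ℂ) : E → ℂ :=
  Function.extend Subtype.val f 0

lemma extendSphere_coe {E : Type*} [NormedAddCommGroup E] (f : Metric.sphere (0 : E) 1 → ℂ)
    (n : Metric.sphere (0 : E) 1) : extendSphere f n = f n :=
  Subtype.val_injective.extend_apply f 0 n

variable {E : Type*} [NormedAddCommGroup E] [InnerProductSpace ℝ E] {κ : ℝ} {u v F G : E → ℂ}
  {f : Metric.sphere (0 : E) 1 → ℂ}

lemma HasFarField.sub (hu : HasFarField κ u F) (hv : HasFarField κ v G) :
    HasFarField κ (fun x => u x - v x) (fun n => F n - G n) where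
  continuous := hu.continuous.sub hv.continuous
  continuousOn := hu.continuousOn.sub hv.continuousOn
  asymptotics := by
    rw [← sub_zero (0 : ℂ)]
    exact (hu.asymptotics.sub hv.asymptotics).congr fun x => by ring

lemma HasFarField.of_tendstoUniformly (hu : Continuous u)
    (h : TendstoUniformly (fun (r : ℝ) (n : Metric.sphere (0 : E) 1) =>
      phase (-(κ * r)) * (r * u (r • (n : E)))) f atTop) :
    HasFarField κ u (extendSphere f) where
  continuous := hu
  continuousOn := by
    rw [continuousOn_iff_continuous_domRestrict]
    have hrestrict : (Metric.sphere (0 : E) 1).domRestrict (extendSphere f) = f :=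
      funext (extendSphere_coe f)
    rw [hrestrict]
    exact h.continuous (Frequently.of_forall fun r =>
      continuous_const.mul (continuous_const.mul (hu.comp (by fun_prop))))
  asymptotics := by
    rw [Metric.tendsto_nhds]
    intro ε hε
    have huniform := (tendsto_norm_cobounded_atTop (E := E)).eventually
      (Metric.tendstoUniformly_iff.1 h ε hε)
    filter_upwards [huniform, (eventually_cobounded_le_norm 1)] with x hx hnorm
    have hx0 : x ≠ 0 := norm_pos_iff.1 (one_pos.trans_le hnorm)
    let n : Metric.sphere (0 : E) 1 := ⟨normalize x, normalize_mem_sphere hx0⟩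
    have hrescale : (‖x‖ : ℂ) * u x - phase (κ * ‖x‖) * extendSphere f (normalize x) =
        phase (κ * ‖x‖) * (phase (-(κ * ‖x‖)) * (‖x‖ * u (‖x‖ • (n : E))) - f n) := by
      rw [← extendSphere_coe f n, norm_smul_normalize]
      linear_combination -((‖x‖ : ℂ) * u x) * phase_neg_mul_phase (κ * ‖x‖)
    rw [dist_zero_right, hrescale, norm_mul, norm_phase, one_mul, ← dist_eq_norm, dist_comm]
    exact hx n

lemma tendstoUniformly_of_norm_sub_le {C r₀ : ℝ} (h : ∀ r : ℝ, r₀ ≤ r →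
    ∀ n : Metric.sphere (0 : E) 1, ‖u (r • (n : E)) - phase (κ * r) / r * f n‖ ≤ C / r ^ 2) :
    TendstoUniformly (fun (r : ℝ) (n : Metric.sphere (0 : E) 1) =>
      phase (-(κ * r)) * (r * u (r • (n : E)))) f atTop := by
  rw [Metric.tendstoUniformly_iff]
  intro ε hε
  have hlimit : Tendsto (fun r : ℝ => C / r) atTop (𝓝 0) := tendsto_const_nhds.div_atTop tendsto_id
  filter_upwards [hlimit.eventually (gt_mem_nhds hε), eventually_ge_atTop r₀,
    eventually_gt_atTop 0] with r hr hr₀ hrpos n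
  have hrescale : phase (-(κ * r)) * (r * u (r • (n : E))) - f n =
      phase (-(κ * r)) * (r * (u (r • (n : E)) - phase (κ * r) / r * f n)) := by
    have hne : (r : ℂ) ≠ 0 := by exact_mod_cast hrpos.ne'
    field_simp
    linear_combination f n * phase_neg_mul_phase (κ * r)
  rw [dist_comm, dist_eq_norm, hrescale, norm_mul, norm_phase, one_mul, norm_mul,
    Complex.norm_real, Real.norm_of_nonneg hrpos.le]
  calc r * ‖u (r • (n : E)) - phase (κ * r) / r * f n‖ ≤ r * (C / r ^ 2) := by
        gcongr
        exact h r hr₀ n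
    _ = C / r := by field_simp
    _ < ε := hr

end SphereAmplitude

section PlaneWave

lemma laplacian_phase_inner {E : Type*} [NormedAddCommGroup E] [InnerProductSpace ℝ E]
    [FiniteDimensional ℝ E] (κ : ℝ) (n x : E) :
    (Δ fun y => phase (κ * inner ℝ n y)) x =
      -((κ * ‖n‖ : ℝ) : ℂ) ^ 2 * phase (κ * inner ℝ n x) := by
  have hsecond (a : E) : fderiv ℝ (fun y => Complex.I * (κ * inner ℝ n a : ℝ) *
      phase (κ * inner ℝ n y)) x a =
      -(((κ * inner ℝ n a) ^ 2 : ℝ) : ℂ) * phase (κ * inner ℝ n x) := by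
    rw [fderiv_const_mul ((contDiff_phase_inner κ n (m := 1)).differentiable one_ne_zero x),
      smul_apply, fderiv_phase_inner]
    push_cast
    linear_combination (norm := (simp only [smul_eq_mul]; push_cast; ring))
      (κ * inner ℝ n a : ℂ) ^ 2 * phase (κ * inner ℝ n x) * Complex.I_sq
  rw [laplacian_eq_sum_fderiv (contDiff_phase_inner κ n)]
  simp only [fderiv_phase_inner, hsecond]
  rw [← Finset.sum_mul, Finset.sum_neg_distrib, ← Complex.ofReal_sum]
  simp only [mul_pow, ← Finset.mul_sum, (stdOrthonormalBasis ℝ E).sum_sq_inner_left]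
  push_cast
  ring

lemma planeWave_smul (κ : ℝ) (n : Space3) :
    planeWave (κ • n) = fun x => phase (κ * inner ℝ n x) := by
  ext x
  rw [planeWave, phase, real_inner_smul_left]

lemma planeWave_eq_phase (k : Space3) : planeWave k = fun x => phase (1 * inner ℝ k x) := by
  rw [← planeWave_smul, one_smul]

lemma norm_planeWave (k x : Space3) : ‖planeWave k x‖ = 1 := by
  rw [planeWave_eq_phase]
  exact norm_phase _

lemma contDiff_planeWave (k : Space3) {m : WithTop ℕ∞} : ContDiff ℝ m (planeWave k) := by
  rw [planeWave_eq_phase]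
  exact contDiff_phase_inner 1 k

lemma laplacian_planeWave (k x : Space3) :
    (Δ (planeWave k)) x = -(‖k‖ : ℂ) ^ 2 * planeWave k x := by
  rw [planeWave_eq_phase, laplacian_phase_inner]
  simp

lemma isWeakHelmholtz_planeWave (k : Space3) : IsWeakHelmholtz ‖k‖ (planeWave k) 0 :=
  .of_laplacian (contDiff_planeWave k) fun x => by
    rw [laplacian_planeWave, Pi.zero_apply]
    ring

end PlaneWave

section Potential

variable {V : Space3 → ℝ}

lemma _root_.IsShortRange.locallyIntegrable (hV : IsShortRange V) : LocallyIntegrable V := by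
  rw [locallyIntegrable_iff]
  intro K hK
  have : IsFiniteMeasure (volume.restrict K) := ⟨by simpa using hK.measure_lt_top⟩
  exact (hV.locally_sq_integrable K hK).integrable one_le_two

lemma isBigO_exp_neg_norm_div_rpow {E : Type*} [NormedAddCommGroup E] {a : ℝ} (ha : 0 < a)
    (b : ℝ) : (fun x : E => Real.exp (-‖x‖ / a)) =O[cobounded E] fun x => (1 + ‖x‖) ^ b := by
  have hshift : Tendsto (fun x : E => 1 + ‖x‖) (cobounded E) atTop :=
    tendsto_atTop_add_const_left _ _ tendsto_norm_cobounded_atTop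
  refine Asymptotics.IsBigO.trans ?_
    ((isLittleO_exp_neg_mul_rpow_atTop (inv_pos.2 ha) b).isBigO.comp_tendsto hshift)
  refine Asymptotics.IsBigO.of_bound (Real.exp a⁻¹) (Eventually.of_forall fun x => le_of_eq ?_)
  simp only [Function.comp_apply, Real.norm_eq_abs, Real.abs_exp]
  rw [← Real.exp_add]
  congr 1
  field_simp
  ring

lemma _root_.IsShortRange.integrable (hV : IsShortRange V) : Integrable V := by
  obtain ⟨a, ha, hdecay⟩ := hV.exp_decay
  have hpower := hdecay.trans (isBigO_exp_neg_norm_div_rpow ha (-4))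
  rw [Metric.cobounded_eq_cocompact] at hpower
  have hfinrank : (Module.finrank ℝ Space3 : ℝ) < 4 := by
    rw [finrank_euclideanSpace_fin]
    norm_num
  exact hV.locallyIntegrable.integrable_of_isBigO_cocompact hpower
    ((integrable_one_add_norm hfinrank).integrableAtFilter _)

lemma locallyIntegrable_ofReal_mul {E : Type*} [TopologicalSpace E] [MeasurableSpace E]
    [OpensMeasurableSpace E] [LocallyCompactSpace E] [T2Space E]
    {μ : Measure E} {V : E → ℝ} (hV : LocallyIntegrable V μ) {u : E → ℂ} (hu : Continuous u) :
    LocallyIntegrable (fun x => (V x : ℂ) * u x) μ := by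
  rw [locallyIntegrable_iff] at hV ⊢
  exact fun K hK =>
    IntegrableOn.mul_continuousOn (Integrable.ofReal (hV K hK)) hu.continuousOn hK

lemma _root_.IsSchrodingerViolation.isWeakHelmholtz {M : ℝ} (hM : 0 < M)
    (hV : LocallyIntegrable V) {k : Space3} {u g : Space3 → ℂ} (hu : Continuous u)
    (h : IsSchrodingerViolation M V (kineticEnergy M k) u g) :
    IsWeakHelmholtz ‖k‖ u fun x => 2 * M * (g x + V x * u x) := by
  intro η hη hc
  have hMne : (M : ℂ) ≠ 0 := by exact_mod_cast hM.ne'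
  have hsource {s : Space3 → ℂ} (hs : LocallyIntegrable s) : Integrable fun x => s x * η x := by
    simpa only [smul_eq_mul, mul_comm] using
      hs.integrable_smul_left_of_hasCompactSupport hη.continuous hc
  have hfield : Integrable fun x => u x * ((Δ η) x + (‖k‖ : ℂ) ^ 2 * η x) :=
    (hu.mul ((continuous_laplacian (hη.of_le (by norm_cast))).add
      (continuous_const.mul hη.continuous))).integrable_of_hasCompactSupport
      ((hasCompactSupport_laplacian hc).add hc.mul_left).mul_left
  have hVu := hsource (locallyIntegrable_ofReal_mul hV hu)
  have henergy (x) : u x * ((kineticEnergy M k : ℂ) * η x + (Δ η) x / (2 * (M : ℂ)) -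
      (V x : ℂ) * η x) =
      (2 * M : ℂ)⁻¹ * (u x * ((Δ η) x + (‖k‖ : ℂ) ^ 2 * η x)) - V x * u x * η x := by
    rw [kineticEnergy]
    push_cast
    field_simp
    ring
  have htest := h.2 η hη hc
  simp only [henergy] at htest
  rw [integral_sub (hfield.const_mul _) hVu, integral_const_mul] at htest
  simp only [mul_assoc (2 * M : ℂ), add_mul]
  rw [integral_const_mul, integral_add (hsource h.1) hVu, htest, sub_add_cancel,
    mul_inv_cancel_left₀ (mul_ne_zero two_ne_zero hMne)]

end Potential

section ScatteringForm

variable {k : Space3} {ψ ψ' : Space3 → ℂ} {f f' : CelestialSphere → ℂ}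

lemma _root_.HasScatteringForm.hasFarField_sub_planeWave (h : HasScatteringForm k ψ f) :
    HasFarField ‖k‖ (fun x => ψ x - planeWave k x) (extendSphere f) := by
  obtain ⟨C, r₀, -, hasymptotics⟩ := h.asymptotics
  have hcontinuous : Continuous fun x => ψ x - planeWave k x :=
    h.continuous.sub (contDiff_planeWave k (m := 0)).continuous
  have huniform := tendstoUniformly_of_norm_sub_le (κ := ‖k‖) (u := fun x => ψ x - planeWave k x)
    (f := f) hasymptotics
  exact .of_tendstoUniformly hcontinuous huniform

lemma _root_.HasScatteringForm.hasFarField_sub (h : HasScatteringForm k ψ f)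
    (h' : HasScatteringForm k ψ' f') :
    HasFarField ‖k‖ (fun x => ψ x - ψ' x) fun n => extendSphere f n - extendSphere f' n := by
  simpa only [sub_sub_sub_cancel_right] using
    h.hasFarField_sub_planeWave.sub h'.hasFarField_sub_planeWave

lemma _root_.HasScatteringForm.exists_bound (h : HasScatteringForm k ψ f) :
    ∃ B, ∀ x, ‖ψ x‖ ≤ B := by
  obtain ⟨B, hB⟩ := h.hasFarField_sub_planeWave.exists_bound
  refine ⟨B + 1, fun x => ?_⟩
  calc ‖ψ x‖ ≤ ‖ψ x - planeWave k x‖ + ‖planeWave k x‖ := norm_le_norm_sub_add _ _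
    _ ≤ B + 1 := add_le_add (hB x) (norm_planeWave k x).le

lemma enorm_le_supNorm (ψ : Space3 → ℂ) (x : Space3) : ‖ψ x‖ₑ ≤ supNorm ψ :=
  le_iSup (fun x => ‖ψ x‖ₑ) x

lemma _root_.HasScatteringForm.supNorm_ne_zero (h : HasScatteringForm k ψ f) :
    supNorm ψ ≠ 0 := by
  intro hzero
  have hψ (x : Space3) : ψ x = 0 :=
    enorm_eq_zero.1 (le_antisymm (hzero ▸ enorm_le_supNorm ψ x) zero_le)
  have hlimit := h.hasFarField_sub_planeWave.tendsto_zero.norm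
  simp only [hψ, zero_sub, norm_neg, norm_planeWave, norm_zero] at hlimit
  exact one_ne_zero (tendsto_nhds_unique tendsto_const_nhds hlimit)

end ScatteringForm

section Amplitude

variable {M : ℝ} {V : Space3 → ℝ} {k : Space3} {ψ ψt ξ g : Space3 → ℂ}
  {f ft h : CelestialSphere → ℂ}

lemma _root_.HasScatteringForm.isOutgoingSolution_sub (hM : 0 < M) (hV : Integrable V)
    (hψt : HasScatteringForm k ψt ft) (hg : IsSchrodingerViolation M V (kineticEnergy M k) ψt g)
    (hgi : Integrable g) (hψ : IsExactScatteringState M V k ψ f) :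
    IsOutgoingSolution ‖k‖ (fun x => ψt x - ψ x) (fun x => 2 * M * (g x + V x * (ψt x - ψ x)))
      fun n => extendSphere ft n - extendSphere f n where
  farField := hψt.hasFarField_sub hψ.form
  integrable := by
    have hfar := hψt.hasFarField_sub hψ.form
    obtain ⟨B, hB⟩ := hfar.exists_bound
    exact (hgi.add (hV.ofReal.mul_bdd hfar.continuous.aestronglyMeasurable
      (ae_of_all _ hB))).const_mul _
  weak := by
    have hsource {u w : Space3 → ℂ} (hw : LocallyIntegrable w) (hu : Continuous u) :
        LocallyIntegrable fun x => 2 * M * (w x + V x * u x) :=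
      (hw.add (locallyIntegrable_ofReal_mul hV.locallyIntegrable hu)).smul (2 * M : ℂ)
    convert (hg.isWeakHelmholtz hM hV.locallyIntegrable hψt.continuous).sub
      (hψ.eigenstate.isWeakHelmholtz hM hV.locallyIntegrable hψ.form.continuous)
      hψt.continuous hψ.form.continuous (hsource hg.1 hψt.continuous)
      (hsource hψ.eigenstate.1 hψ.form.continuous) using 2 with x
    rw [Pi.zero_apply]
    ring

lemma _root_.IsExactScatteringState.isOutgoingSolution_sub_planeWave (hM : 0 < M)
    (hV : Integrable V) (hψ : IsExactScatteringState M V k ψ f) :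
    IsOutgoingSolution ‖k‖ (fun x => ψ x - planeWave k x) (fun x => 2 * M * (V x * ψ x))
      (extendSphere f) where
  farField := hψ.form.hasFarField_sub_planeWave
  integrable := by
    obtain ⟨B, hB⟩ := hψ.form.exists_bound
    exact (hV.ofReal.mul_bdd hψ.form.continuous.aestronglyMeasurable (ae_of_all _ hB)).const_mul _
  weak := by
    have hVψ := locallyIntegrable_ofReal_mul hV.locallyIntegrable hψ.form.continuous
    have hhelmholtz := hψ.eigenstate.isWeakHelmholtz hM hV.locallyIntegrable hψ.form.continuous
    simp only [Pi.zero_apply, zero_add] at hhelmholtz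
    simpa only [Pi.zero_apply, sub_zero] using hhelmholtz.sub (isWeakHelmholtz_planeWave k)
      hψ.form.continuous (contDiff_planeWave k (m := 0)).continuous (hVψ.smul (2 * M : ℂ))
      locallyIntegrable_zero

lemma IsOutgoingSolution.amplitude_eq_integral_sub {κ : ℝ} {u s F w t G : Space3 → ℂ}
    (hu : IsOutgoingSolution κ u s F) (n : CelestialSphere)
    (hw : IsOutgoingSolution κ (fun x => w x - planeWave (-(κ • (n : Space3))) x) t G) :
    (-(4 * Real.pi) : ℝ) * F n = ∫ x, (s x * w x - u x * t x) := by
  obtain ⟨B, hB⟩ := hu.farField.exists_bound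
  obtain ⟨D, hD⟩ := hw.farField.exists_bound
  have htransform : transform κ s (-n) = ∫ x, s x * planeWave (-(κ • (n : Space3))) x := by
    rw [transform, ← smul_neg, planeWave_smul]
  have hplane : Integrable fun x => s x * planeWave (-(κ • (n : Space3))) x :=
    hu.integrable.mul_bdd (contDiff_planeWave _ (m := 0)).continuous.aestronglyMeasurable
      (ae_of_all _ fun x => (norm_planeWave _ x).le)
  have hdiff : Integrable fun x => s x * (w x - planeWave (-(κ • (n : Space3))) x) :=
    hu.integrable.mul_bdd hw.farField.continuous.aestronglyMeasurable (ae_of_all _ hD)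
  have hut : Integrable fun x => u x * t x :=
    hw.integrable.bdd_mul hu.farField.continuous.aestronglyMeasurable (ae_of_all _ hB)
  rw [hu.amplitude_eq n.2, htransform]
  calc ∫ x, s x * planeWave (-(κ • (n : Space3))) x
      = (∫ x, s x * planeWave (-(κ • (n : Space3))) x) +
          ((∫ x, s x * (w x - planeWave (-(κ • (n : Space3))) x)) - ∫ x, u x * t x) := by
        rw [hu.reciprocity hw, sub_self, add_zero]
    _ = ∫ x, (s x * planeWave (-(κ • (n : Space3))) x +
          (s x * (w x - planeWave (-(κ • (n : Space3))) x) - u x * t x)) := by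
        rw [← integral_sub hdiff hut]
        exact (integral_add hplane (hdiff.sub hut)).symm
    _ = ∫ x, (s x * w x - u x * t x) := by
        congr with x
        ring

lemma amplitude_error_eq (hM : 0 < M) (hV : Integrable V) (hψ : IsExactScatteringState M V k ψ f)
    (hψt : HasScatteringForm k ψt ft) (hg : IsSchrodingerViolation M V (kineticEnergy M k) ψt g)
    (hgi : Integrable g) (n : CelestialSphere)
    (hξ : IsExactScatteringState M V (-(‖k‖ • (n : Space3))) ξ h) :
    ft n - f n = (-(M / (2 * Real.pi)) : ℝ) * ∫ x, g x * ξ x := by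
  have hnorm : ‖-(‖k‖ • (n : Space3))‖ = ‖k‖ := by
    rw [norm_neg, norm_smul, norm_norm, norm_eq_of_mem_sphere, mul_one]
  have houtgoing := hξ.isOutgoingSolution_sub_planeWave hM hV
  rw [hnorm] at houtgoing
  have hpairing := (hψt.isOutgoingSolution_sub hM hV hg hgi hψ).amplitude_eq_integral_sub n
    houtgoing
  have hpotential (x) : 2 * M * (g x + V x * (ψt x - ψ x)) * ξ x -
      (ψt x - ψ x) * (2 * M * (V x * ξ x)) = 2 * M * (g x * ξ x) := by ring
  simp only [hpotential, extendSphere_coe, integral_const_mul] at hpairing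
  have hpi : (Real.pi : ℂ) ≠ 0 := by exact_mod_cast Real.pi_ne_zero
  push_cast at hpairing ⊢
  field_simp
  linear_combination (-1 / 2 : ℂ) * hpairing

lemma amplitude_error_le (hM : 0 < M) (hV : Integrable V) (hψ : IsExactScatteringState M V k ψ f)
    (hψt : HasScatteringForm k ψt ft) (hg : IsSchrodingerViolation M V (kineticEnergy M k) ψt g)
    (n : CelestialSphere) (hξ : IsExactScatteringState M V (-(‖k‖ • (n : Space3))) ξ h) :
    ‖ft n - f n‖ₑ ≤ ENNReal.ofReal (M / Real.pi) * supNorm ξ * lOneNorm g := by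
  have hpi := Real.pi_pos
  have hfactor : ENNReal.ofReal (M / Real.pi) ≠ 0 := by simpa using div_pos hM hpi
  rcases eq_or_ne (lOneNorm g) ⊤ with htop | hfinite
  · rw [htop, ENNReal.mul_top (mul_ne_zero hfactor hξ.form.supNorm_ne_zero)]
    exact le_top
  have hgi : Integrable g := ⟨hg.1.aestronglyMeasurable, hfinite.lt_top⟩
  have hconst : ‖((-(M / (2 * Real.pi)) : ℝ) : ℂ)‖ₑ ≤ ENNReal.ofReal (M / Real.pi) := by
    rw [← ofReal_norm, Complex.norm_real, norm_neg, Real.norm_of_nonneg (by positivity)]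
    gcongr
    linarith
  have hintegral : ‖∫ x, g x * ξ x‖ₑ ≤ supNorm ξ * lOneNorm g :=
    calc ‖∫ x, g x * ξ x‖ₑ ≤ ∫⁻ x, ‖g x * ξ x‖ₑ := enorm_integral_le_lintegral_enorm _
      _ ≤ ∫⁻ x, supNorm ξ * ‖g x‖ₑ := by
          refine lintegral_mono fun x => ?_
          rw [enorm_mul, mul_comm]
          gcongr
          exact enorm_le_supNorm ξ x
      _ = supNorm ξ * lOneNorm g := lintegral_const_mul'' _ hgi.aestronglyMeasurable.enorm
  rw [amplitude_error_eq hM hV hψ hψt hg hgi n hξ, enorm_mul, mul_assoc]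
  exact mul_le_mul' hconst hintegral

end Amplitude

section Symmetry

variable {M : ℝ} {V : Space3 → ℝ} {k : Space3} {ψ : Space3 → ℂ} {f : CelestialSphere → ℂ}

lemma planeWave_symm_apply (A : Space3 ≃ₗᵢ[ℝ] Space3) (k x : Space3) :
    planeWave (A.symm k) x = planeWave k (A x) := by
  rw [planeWave, planeWave, ← A.inner_map_map, A.apply_symm_apply]

lemma _root_.HasScatteringForm.comp_isometry (h : HasScatteringForm k ψ f)
    (A : Space3 ≃ₗᵢ[ℝ] Space3) :
    HasScatteringForm (A.symm k) (fun x => ψ (A x)) fun n => f ⟨A n, by simp⟩ where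
  continuous := h.continuous.comp A.continuous
  asymptotics := by
    obtain ⟨C, r₀, hr₀, hbound⟩ := h.asymptotics
    refine ⟨C, r₀, hr₀, fun r hr n => ?_⟩
    rw [planeWave_symm_apply, map_smul, A.symm.norm_map]
    exact hbound r hr ⟨A n, by simp⟩

lemma _root_.IsExactScatteringState.comp_isometry (hψ : IsExactScatteringState M V k ψ f)
    (A : Space3 ≃ₗᵢ[ℝ] Space3) (hV : ∀ x, V (A x) = V x) :
    IsExactScatteringState M V (A.symm k) (fun x => ψ (A x)) fun n => f ⟨A n, by simp⟩ where
  form := hψ.form.comp_isometry A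
  eigenstate := by
    refine ⟨locallyIntegrable_zero, fun η hη hc => ?_⟩
    have hlaplacian (x) : (Δ fun x => η (A.symm x)) x = (Δ η) (A.symm x) := by
      simpa using laplacian_comp_isometry_add (u := η) A.symm 0 x
    have htest := hψ.eigenstate.2 (fun x => η (A.symm x)) (hη.comp A.symm.contDiff)
      (hc.comp_homeomorph A.symm.toHomeomorph)
    simp only [hlaplacian, Pi.zero_apply, zero_mul, integral_zero] at htest
    rw [← A.measurePreserving.integral_comp A.toHomeomorph.measurableEmbedding] at htest
    simp only [A.symm_apply_apply, hV] at htest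
    simpa only [kineticEnergy, A.symm.norm_map, Pi.zero_apply, zero_mul, integral_zero] using htest

lemma supNorm_comp_isometry (A : Space3 ≃ₗᵢ[ℝ] Space3) (ψ : Space3 → ℂ) :
    supNorm (fun x => ψ (A x)) = supNorm ψ :=
  A.toEquiv.iSup_comp (g := fun x => ‖ψ x‖ₑ)

end Symmetry

end Scattering

theorem mainTheorem6_general {M : ℝ} (hM : 0 < M) {V : Space3 → ℝ} (hV : Integrable V)
    {k : Space3} {ψ : Space3 → ℂ} {f : CelestialSphere → ℂ}
    (hψ : IsExactScatteringState M V k ψ f)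
    {ψt : Space3 → ℂ} {ft : CelestialSphere → ℂ} (hψt : HasScatteringForm k ψt ft)
    {g : Space3 → ℂ} (hg : IsSchrodingerViolation M V (kineticEnergy M k) ψt g)
    (n : CelestialSphere) :
    (∀ (ξ : Space3 → ℂ) (h : CelestialSphere → ℂ),
      IsExactScatteringState M V (-(‖k‖ • (n : Space3))) ξ h →
        ‖ft n - f n‖ₑ ≤ ENNReal.ofReal (M / Real.pi) * supNorm ξ * lOneNorm g) ∧
    ((∀ x y : Space3, ‖x‖ = ‖y‖ → V x = V y) →
      ‖ft n - f n‖ₑ ≤ ENNReal.ofReal (M / Real.pi) * supNorm ψ * lOneNorm g) := by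
  refine ⟨fun ξ h hξ => Scattering.amplitude_error_le hM hV hψ hψt hg n hξ, fun hsymm => ?_⟩
  let A := (Submodule.span ℝ {k - -(‖k‖ • (n : Space3))})ᗮ.reflection
  have hnorm : ‖k‖ = ‖-(‖k‖ • (n : Space3))‖ := by
    rw [norm_neg, norm_smul, norm_norm, norm_eq_of_mem_sphere, mul_one]
  have hswap : A.symm k = -(‖k‖ • (n : Space3)) := by
    rw [Submodule.reflection_symm]
    exact Submodule.reflection_sub hnorm
  have hreflected := hψ.comp_isometry A fun x => hsymm _ _ (A.norm_map x)
  rw [hswap] at hreflected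
  rw [← Scattering.supNorm_comp_isometry A ψ]
  exact Scattering.amplitude_error_le hM hV hψ hψt hg n hreflected

theorem mainTheorem6
    (M : ℝ) (hM : 0 < M) (V : Space3 → ℝ) (hV : IsShortRange V)
    (k : Space3) (hk : k ≠ 0)
    (ψ : Space3 → ℂ) (f : CelestialSphere → ℂ) (hψ : IsExactScatteringState M V k ψ f)
    (ψt : Space3 → ℂ) (ft : CelestialSphere → ℂ) (hψt : HasScatteringForm k ψt ft)
    (g : Space3 → ℂ) (hg : IsSchrodingerViolation M V (kineticEnergy M k) ψt g)
    (p : Space3) (hp : ‖p‖ = ‖k‖)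
    (n : CelestialSphere) (hn : (n : Space3) = ‖p‖⁻¹ • p) :
    (∀ (ξ : Space3 → ℂ) (h : CelestialSphere → ℂ), IsExactScatteringState M V (-p) ξ h →
      ‖ft n - f n‖ₑ ≤ ENNReal.ofReal (M / Real.pi) * supNorm ξ * lOneNorm g) ∧
    ((∀ x y : Space3, ‖x‖ = ‖y‖ → V x = V y) →
      ‖ft n - f n‖ₑ ≤ ENNReal.ofReal (M / Real.pi) * supNorm ψ * lOneNorm g) := by
  have hmomentum : ‖k‖ • (n : Space3) = p := by
    rw [hn, hp, smul_inv_smul₀ (norm_ne_zero_iff.2 hk)]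
  exact hmomentum ▸ mainTheorem6_general hM hV.integrable hψ hψt hg n
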